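/- Let $d_1,d_2\ge 1$ and let $U,V$ be unitary operators on $\mathbb{C}^{d_1}\otimes\mathbb{C}^{d_2}$ (Alice's system and Bob's system), with unitary channels $\Psi_U(\rho)=U\rho U^\dagger$ and $\Psi_V(\rho)=V\rho V^\dagger$. Alice and Bob test the null hypothesis $H_0$, that an unknown channel is $\Psi_U$, against $H_1$, that it is $\Psi_V$. For this they choose auxiliary systems $\mathbb{C}^{e_1}$ (Alice) and $\mathbb{C}^{e_2}$ (Bob) of any dimensions, an input state $\rho$ that can be prepared by local operations and classical communication (LOCC) with respect to the partition $\mathbb{C}^{d_1}\otimes\mathbb{C}^{e_1}:\mathbb{C}^{d_2}\otimes\mathbb{C}^{e_2}$, and a measurement $\Omega=\{\Omega_0,\Omega_1\}$ that can be realized by LOCC with respect to the same partition. They accept $H_0$ on outcome $0$ and $H_1$ on outcome $1$. The error probabilities are $$p_{\mathrm I}(\Omega,\rho)=\operatorname{tr}\bigl(\Omega_1(\Psi_U\otimes\mathrm{id})(\rho)\bigr),\qquad p_{\mathrm{II}}(\Omega,\rho)=\operatorname{tr}\bigl(\Omega_0(\Psi_V\otimes\mathrm{id})(\rho)\bigr).$$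 LOCC protocols have finitely many rounds; in each round one party applies a local quantum instrument with finitely many outcomes, possibly depending on all earlier outcomes, and announces the outcome. Let $$W^{\otimes}_{d_1:d_2}(X)=\{\langle a\otimes b|X|a\otimes b\rangle : a\in\mathbb{C}^{d_1},\ b\in\mathbb{C}^{d_2},\ \|a\|=\|b\|=1\}$$ be the product numerical range, and let $z$ be the Euclidean distance from $0$ to $W^{\otimes}_{d_1:d_2}(V^\dagger U)$. Then: 1. The distance is attained: $z=\min\{|x| : x\in W^{\otimes}_{d_1:d_2}(V^\dagger U)\}$. 2. For every significance level $\delta\in[0,1]$ the minimum of $p_{\mathrm{II}}(\Omega,\rho)$ over all $e_1,e_2$ and all LOCC states $\rho$ and LOCC measurements $\Omega$ with $p_{\mathrm I}(\Omega,\rho)\le\delta$ exists and equals $$p_{\mathrm{II}}(U,V)=\begin{cases}0, & z\le\sqrt\delta,\\ \bigl(z\sqrt{1-\delta}-\sqrt{1-z^2}\,\sqrt\delta\bigr)^2, & z>\sqrt\delta.\end{cases}$$ 3. The minimum is attained without auxiliary systems, from a pure product state and with one-way communication. More precisely, let $a,b$ be any unit vectors with $|\langle a\otimes b|V^\dagger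 U|a\otimes b\rangle|=z$. For every $\delta\in[0,1]$ the input state $|a\rangle\langle a|\otimes|b\rangle\langle b|$ attains the minimum (with $p_{\mathrm I}\le\delta$) with a measurement of the following form: Alice measures in an orthonormal basis and sends her outcome $i$ to Bob, Bob measures in an orthonormal basis that depends on $i$, with outcome $j$, and the final label in $\{0,1\}$ is obtained by classical post-processing of $(i,j)$. The post-processing can be chosen deterministic if $d_1d_2\ge2$, and can be chosen to depend on $j$ only if $d_2\ge2$. -/

import Mathlib

open scoped Matrix Kronecker

namespace LocalCertification

/-! Finite-dimensional systems. A system of dimension `n` is `ℂⁿ`, operators on it are matrices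
over `Fin n`, and operators on a bipartite system `ℂᵃ ⊗ ℂᵇ` are matrices over `Fin a × Fin b`. -/

/-- Operators on the bipartite system `ℂᵃ ⊗ ℂᵇ` (first factor: Alice, second factor: Bob). -/
abbrev BiOp (a b : ℕ) : Type := Matrix (Fin a × Fin b) (Fin a × Fin b) ℂ

/-- The tensor product of two vectors. -/
def tensorVec {a b : ℕ} (x : Fin a → ℂ) (y : Fin b → ℂ) : Fin a × Fin b → ℂ :=
  fun p => x p.1 * y p.2

/-- A normalized vector, `⟨x|x⟩ = 1`. -/
def IsUnitVec {ι : Type} [Fintype ι] (x : ι → ℂ) : Prop := star x ⬝ᵥ x = 1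

/-- The rank-one operator `|x⟩⟨x|`. -/
def proj {ι : Type} (x : ι → ℂ) : Matrix ι ι ℂ := Matrix.vecMulVec x (star x)

/-- The quadratic form `⟨x|X|x⟩`. -/
def quadForm {ι : Type} [Fintype ι] (X : Matrix ι ι ℂ) (x : ι → ℂ) : ℂ := star x ⬝ᵥ (X *ᵥ x)

/-- The product numerical range of a matrix on `ℂᵃ ⊗ ℂᵇ`. -/
def productNumericalRange {a b : ℕ} (X : BiOp a b) : Set ℂ :=
  {w | ∃ (x : Fin a → ℂ) (y : Fin b → ℂ), IsUnitVec x ∧ IsUnitVec y ∧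
    w = quadForm X (tensorVec x y)}

/-- The Euclidean distance between `0` and the product numerical range. -/
noncomputable def distToZero {a b : ℕ} (X : BiOp a b) : ℝ :=
  Metric.infDist (0 : ℂ) (productNumericalRange X)

/-! ### Local operations and classical communication -/

/-- A finite LOCC protocol, as a tree. It takes a bipartite system of dimensions `a : b` to one of
dimensions `a' : b'` and issues a classical label in `O`, known to both parties. In each round one
party applies a local quantum instrument, given by Kraus operators `K k` with `∑ₖ (K k)ᴴ (K k) = 1`
(the dimension after the round may depend on the outcome), and announces the outcome `k`; the rest
of the protocol depends on all outcomes announced so far. An instrument with several Kraus operators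
per announced outcome (in particular any local channel) is the case in which the continuation does
not depend on the whole of `k`. -/
inductive Protocol (O : Type) (a' b' : ℕ) : ℕ → ℕ → Type
  | halt (o : O) : Protocol O a' b' a' b'
  | alice {a b n : ℕ} (c : Fin n → ℕ) (K : (k : Fin n) → Matrix (Fin (c k)) (Fin a) ℂ)
      (hK : ∑ k, (K k)ᴴ * K k = 1) (next : (k : Fin n) → Protocol O a' b' (c k) b) :
      Protocol O a' b' a b
  | bob {a b n : ℕ} (c : Fin n → ℕ) (K : (k : Fin n) → Matrix (Fin (c k)) (Fin b) ℂ)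
      (hK : ∑ k, (K k)ᴴ * K k = 1) (next : (k : Fin n) → Protocol O a' b' a (c k)) :
      Protocol O a' b' a b

open Classical in
/-- The quantum instrument realized by a protocol: `P.run o ρ` is the unnormalized final operator
on the event that the label is `o`, its trace being the probability of that label. -/
noncomputable def Protocol.run {O : Type} {a' b' : ℕ} :
    {a b : ℕ} → Protocol O a' b' a b → O → BiOp a b → BiOp a' b'
  | _, _, .halt o', o, ρ => if o' = o then ρ else 0
  | _, b, .alice _ K _ next, o, ρ => ∑ k, (next k).run o
      ((K k ⊗ₖ (1 : Matrix (Fin b) (Fin b) ℂ)) * ρ * (K k ⊗ₖ (1 : Matrix (Fin b) (Fin b) ℂ))ᴴ)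
  | a, _, .bob _ K _ next, o, ρ => ∑ k, (next k).run o
      (((1 : Matrix (Fin a) (Fin a) ℂ) ⊗ₖ K k) * ρ * ((1 : Matrix (Fin a) (Fin a) ℂ) ⊗ₖ K k)ᴴ)

/-- `ρ` can be prepared by LOCC, that is, by an LOCC protocol that starts from the trivial
system `ℂ : ℂ`. -/
def IsLOCCState {a b : ℕ} (ρ : BiOp a b) : Prop :=
  ∃ P : Protocol Unit a b 1 1, ρ = P.run () 1

/-- `{Ω₀, Ω₁}` is a two-outcome measurement that can be realized by LOCC: it is the statistics of
the final label of an LOCC protocol (the remaining system is discarded). -/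
def IsLOCCMeasurement {a b : ℕ} (Ω : Fin 2 → BiOp a b) : Prop :=
  ∃ (a' b' : ℕ) (P : Protocol (Fin 2) a' b' a b),
    ∀ (i : Fin 2) (σ : BiOp a b), (Ω i * σ).trace = (P.run i σ).trace

/-! ### Certification of unitary channels -/

/-- The unitary channel `ρ ↦ U ρ U†`. -/
def unitaryChannel {ι : Type} [Fintype ι] (U ρ : Matrix ι ι ℂ) : Matrix ι ι ℂ := U * ρ * Uᴴ

/-- The map `Φ ⊗ id`. -/
def tensorId {ι κ : Type} (Φ : Matrix ι ι ℂ → Matrix ι ι ℂ) (ρ : Matrix (ι × κ) (ι × κ) ℂ) :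
    Matrix (ι × κ) (ι × κ) ℂ :=
  Matrix.of fun p q => Φ (Matrix.of fun i j => ρ (i, p.2) (j, q.2)) p.1 q.1

/-- Regrouping of the four systems `(ℂ^d₁ ⊗ ℂ^d₂) ⊗ (ℂ^e₁ ⊗ ℂ^e₂)` according to the partition
`ℂ^d₁ ⊗ ℂ^e₁ : ℂ^d₂ ⊗ ℂ^e₂`. -/
def regroup (d₁ d₂ e₁ e₂ : ℕ) :
    (Fin d₁ × Fin d₂) × (Fin e₁ × Fin e₂) ≃ Fin (d₁ * e₁) × Fin (d₂ * e₂) :=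
  (Equiv.prodProdProdComm (Fin d₁) (Fin d₂) (Fin e₁) (Fin e₂)).trans
    (Equiv.prodCongr finProdFinEquiv finProdFinEquiv)

/-- The channel `Ψ_U ⊗ id` on Alice's and Bob's systems and their auxiliary systems of dimensions
`e₁` and `e₂`, as a map on operators for the partition `ℂ^d₁ ⊗ ℂ^e₁ : ℂ^d₂ ⊗ ℂ^e₂`. -/
def extendedChannel {d₁ d₂ : ℕ} (e₁ e₂ : ℕ) (U : BiOp d₁ d₂) (ρ : BiOp (d₁ * e₁) (d₂ * e₂)) :
    BiOp (d₁ * e₁) (d₂ * e₂) :=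
  Matrix.reindex (regroup d₁ d₂ e₁ e₂) (regroup d₁ d₂ e₁ e₂)
    (tensorId (unitaryChannel U)
      (Matrix.reindex (regroup d₁ d₂ e₁ e₂).symm (regroup d₁ d₂ e₁ e₂).symm ρ))

/-- Probability of the outcome with effect `E` in the state `σ`. -/
noncomputable def bornProb {ι : Type} [Fintype ι] (E σ : Matrix ι ι ℂ) : ℝ := (E * σ).trace.re

/-- The type II errors of all tests of `Ψ_U` (null hypothesis, accepted on outcome `0`) against
`Ψ_V` with LOCC input states, LOCC measurements and auxiliary systems of any dimension, whose
type I error is at most `δ`. -/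
def typeIIErrors {d₁ d₂ : ℕ} (U V : BiOp d₁ d₂) (δ : ℝ) : Set ℝ :=
  {p | ∃ (e₁ e₂ : ℕ) (ρ : BiOp (d₁ * e₁) (d₂ * e₂)) (Ω : Fin 2 → BiOp (d₁ * e₁) (d₂ * e₂)),
    IsLOCCState ρ ∧ IsLOCCMeasurement Ω ∧
    bornProb (Ω 1) (extendedChannel e₁ e₂ U ρ) ≤ δ ∧
    p = bornProb (Ω 0) (extendedChannel e₁ e₂ V ρ)}

/-- The claimed optimal type II error for distance `z` and significance level `δ`. -/
noncomputable def optimalError (z δ : ℝ) : ℝ :=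
  if z ≤ √δ then 0 else (z * √(1 - δ) - √(1 - z ^ 2) * √δ) ^ 2

/-- The two-outcome measurement with one-way communication in which Alice measures in the
orthonormal basis of columns of `R` and sends her outcome `i` to Bob, Bob measures in the
orthonormal basis of columns of `S i`, and, on Bob's outcome `j`, the final label is `k` with
probability `f i j k`. -/
noncomputable def oneWayMeasurement {d₁ d₂ : ℕ} (R : Matrix (Fin d₁) (Fin d₁) ℂ)
    (S : Fin d₁ → Matrix (Fin d₂) (Fin d₂) ℂ) (f : Fin d₁ → Fin d₂ → Fin 2 → ℝ) :
    Fin 2 → BiOp d₁ d₂ :=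
  fun k => ∑ i, ∑ j, (f i j k : ℂ) • (proj (R.col i) ⊗ₖ proj ((S i).col j))

end LocalCertification

/-!
The overlap of the two possible output states is `⟨ψ|V†U|ψ⟩`, so the best input brings
this number closest to `0`.

For the converse, the Kraus operators of an LOCC protocol are tensor products. An LOCC state is
therefore a mixture of product vectors of the extended systems. Expanding such a vector along the
ancillas turns its overlap into a sum of values of the form of `V†U` at product vectors, and the
convexity of numerical ranges (Toeplitz–Hausdorff), applied on each side separately, shows that the
sum is at least `z` in modulus. The Cauchy–Schwarz inequality for the effects of the measurement
then gives `z ≤ √β √(1 - α) + √(1 - β) √α` for the type I error `α` and the type II error `β`, which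
trigonometric substitution turns into the bound on `β`.

For the attainment, rotate an orthonormal pair in the span of the two output states until measuring
it gives exactly the errors wanted. The two orthogonal vectors obtained can be discriminated
perfectly with one-way communication: Alice measures in a basis in which a certain traceless matrix
has zero diagonal, which leaves Bob with orthogonal vectors, whatever her outcome is.
-/

namespace LocalCertification

/-! ### Vectors, quadratic forms and unitary matrices -/

section Vectors

variable {ι κ : Type} [Fintype ι] [Fintype κ]

/-- The squared Euclidean norm `⟨x|x⟩` of a vector. (Mathlib's norm on `ι → ℂ` is the sup norm.) -/
noncomputable def sqNorm (x : ι → ℂ) : ℝ := ∑ i, ‖x i‖ ^ 2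

lemma star_dotProduct_self (x : ι → ℂ) : star x ⬝ᵥ x = sqNorm x := by
  rw [sqNorm, Complex.ofReal_sum]
  exact Finset.sum_congr rfl fun i _ ↦ by
    rw [Complex.ofReal_pow]; exact Complex.conj_mul' (x i)

lemma isUnitVec_iff {x : ι → ℂ} : IsUnitVec x ↔ sqNorm x = 1 := by
  rw [IsUnitVec, star_dotProduct_self, Complex.ofReal_eq_one]

lemma sqNorm_nonneg (x : ι → ℂ) : 0 ≤ sqNorm x :=
  Finset.sum_nonneg fun _ _ ↦ sq_nonneg _

@[simp]
lemma sqNorm_zero : sqNorm (0 : ι → ℂ) = 0 := by simp [sqNorm]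

lemma sqNorm_eq_zero {x : ι → ℂ} : sqNorm x = 0 ↔ x = 0 := by
  simp [sqNorm, Finset.sum_eq_zero_iff_of_nonneg, funext_iff]

lemma sqNorm_smul (c : ℂ) (x : ι → ℂ) : sqNorm (c • x) = ‖c‖ ^ 2 * sqNorm x := by
  simp only [sqNorm, Pi.smul_apply, smul_eq_mul, norm_mul, mul_pow, Finset.mul_sum]

lemma sqNorm_comp_equiv (e : κ ≃ ι) (x : ι → ℂ) : sqNorm (x ∘ e) = sqNorm x :=
  e.sum_comp fun i ↦ ‖x i‖ ^ 2

lemma sqNorm_smul_add_smul (p r : ℂ) (x y : ι → ℂ) :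
    sqNorm (p • x + r • y) =
      ‖p‖ ^ 2 * sqNorm x + ‖r‖ ^ 2 * sqNorm y + 2 * (star p * r * (star x ⬝ᵥ y)).re := by
  have hconj : star (star p * r * (star x ⬝ᵥ y)) = star r * p * (star y ⬝ᵥ x) := by
    rw [star_mul', star_mul', star_star, ← Matrix.star_dotProduct, mul_comm p]
  have hre := Complex.add_conj (star p * r * (star x ⬝ᵥ y))
  rw [← Complex.star_def, hconj] at hre
  rw [← Complex.ofReal_inj, ← star_dotProduct_self]
  push_cast at hre ⊢
  rw [← hre, ← Complex.conj_mul', ← Complex.conj_mul', ← star_dotProduct_self,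
    ← star_dotProduct_self]
  simp only [star_add, star_smul, add_dotProduct, dotProduct_add, smul_dotProduct,
    dotProduct_smul, smul_eq_mul, Complex.star_def]
  ring

lemma isUnitVec_inv_sqrt_smul {x : ι → ℂ} (hx : x ≠ 0) :
    IsUnitVec (((√(sqNorm x) : ℝ) : ℂ)⁻¹ • x) := by
  rw [isUnitVec_iff, sqNorm_smul, norm_inv, Complex.norm_real, inv_pow, Real.norm_eq_abs, sq_abs,
    Real.sq_sqrt (sqNorm_nonneg x), inv_mul_cancel₀ (sqNorm_eq_zero.not.2 hx)]

lemma star_mulVec_dotProduct (A : Matrix ι κ ℂ) (x : κ → ℂ) (y : ι → ℂ) :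
    star (A *ᵥ x) ⬝ᵥ y = star x ⬝ᵥ (Aᴴ *ᵥ y) := by
  rw [Matrix.star_mulVec, Matrix.dotProduct_mulVec]

lemma sqNorm_tensorVec {a b : ℕ} (x : Fin a → ℂ) (y : Fin b → ℂ) :
    sqNorm (tensorVec x y) = sqNorm x * sqNorm y := by
  simp only [sqNorm, tensorVec, Fintype.sum_prod_type, Finset.sum_mul_sum, norm_mul, mul_pow]

lemma IsUnitVec.tensorVec {a b : ℕ} {x : Fin a → ℂ} {y : Fin b → ℂ} (hx : IsUnitVec x)
    (hy : IsUnitVec y) : IsUnitVec (tensorVec x y) := by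
  rw [isUnitVec_iff] at hx hy ⊢
  rw [sqNorm_tensorVec, hx, hy, one_mul]

end Vectors

section QuadForm

variable {ι κ : Type} [Fintype ι]

lemma quadForm_smul_add_smul (M : Matrix ι ι ℂ) (p r : ℂ) (x y : ι → ℂ) :
    quadForm M (p • x + r • y) = (‖p‖ : ℂ) ^ 2 * quadForm M x + (‖r‖ : ℂ) ^ 2 * quadForm M y +
      star p * r * (star x ⬝ᵥ (M *ᵥ y)) + star (star p * r) * (star y ⬝ᵥ (M *ᵥ x)) := by
  simp only [quadForm, star_add, star_smul, Matrix.mulVec_add, Matrix.mulVec_smul,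
    add_dotProduct, dotProduct_add, smul_dotProduct, dotProduct_smul, smul_eq_mul,
    ← Complex.conj_mul', star_mul', star_star, ← Complex.star_def]
  ring

lemma quadForm_smul (M : Matrix ι ι ℂ) (c : ℂ) (x : ι → ℂ) :
    quadForm M (c • x) = (‖c‖ : ℂ) ^ 2 * quadForm M x := by
  simpa using quadForm_smul_add_smul M c 0 x 0

@[simp]
lemma quadForm_zero (M : Matrix ι ι ℂ) : quadForm M 0 = 0 := by
  simp [quadForm]

lemma quadForm_smul_left (c : ℂ) (A : Matrix ι ι ℂ) (x : ι → ℂ) :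
    quadForm (c • A) x = c * quadForm A x := by
  rw [quadForm, Matrix.smul_mulVec, dotProduct_smul]; rfl

lemma quadForm_sum_left (s : Finset κ) (A : κ → Matrix ι ι ℂ) (x : ι → ℂ) :
    quadForm (∑ k ∈ s, A k) x = ∑ k ∈ s, quadForm (A k) x := by
  rw [quadForm, Matrix.sum_mulVec, dotProduct_sum]; rfl

lemma quadForm_proj (v x : ι → ℂ) : quadForm (proj v) x = (‖star v ⬝ᵥ x‖ : ℂ) ^ 2 := by
  rw [quadForm, proj, Matrix.vecMulVec_mulVec, dotProduct_smul, Matrix.star_dotProduct x v,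
    ← Complex.conj_mul']
  rfl

lemma quadForm_conjTranspose_mul_mul [Fintype κ] (T : Matrix κ ι ℂ) (X : Matrix κ κ ℂ)
    (x : ι → ℂ) : quadForm (Tᴴ * X * T) x = quadForm X (T *ᵥ x) := by
  rw [quadForm, quadForm, star_mulVec_dotProduct, Matrix.mulVec_mulVec, Matrix.mulVec_mulVec]

lemma quadForm_conjTranspose_mul [Fintype κ] (A B : Matrix κ ι ℂ) (x : ι → ℂ) :
    quadForm (Aᴴ * B) x = star (A *ᵥ x) ⬝ᵥ (B *ᵥ x) := by
  rw [quadForm, star_mulVec_dotProduct, Matrix.mulVec_mulVec]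

lemma trace_mul_proj (E : Matrix ι ι ℂ) (x : ι → ℂ) : (E * proj x).trace = quadForm E x := by
  rw [proj, Matrix.mul_vecMulVec, Matrix.trace_vecMulVec, quadForm, dotProduct_comm]

lemma trace_proj (x : ι → ℂ) : (proj x).trace = sqNorm x := by
  rw [proj, Matrix.trace_vecMulVec, dotProduct_comm, star_dotProduct_self]

lemma mul_proj_mul_conjTranspose (A : Matrix κ ι ℂ) (x : ι → ℂ) :
    A * proj x * Aᴴ = proj (A *ᵥ x) := by
  rw [proj, Matrix.mul_vecMulVec, Matrix.vecMulVec_mul, proj, Matrix.star_mulVec]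

lemma proj_kronecker_proj {a b : ℕ} (x : Fin a → ℂ) (y : Fin b → ℂ) :
    proj x ⊗ₖ proj y = proj (tensorVec x y) := by
  ext p q
  simp only [proj, tensorVec, Matrix.kroneckerMap_apply, Matrix.vecMulVec_apply, Pi.star_apply,
    star_mul']
  ring

end QuadForm

section Unitary

variable {ι : Type} [Fintype ι] [DecidableEq ι]

lemma star_mulVec_dotProduct_mulVec {U : Matrix ι ι ℂ} (hU : U ∈ Matrix.unitaryGroup ι ℂ)
    (x y : ι → ℂ) : star (U *ᵥ x) ⬝ᵥ (U *ᵥ y) = star x ⬝ᵥ y := by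
  rw [star_mulVec_dotProduct, Matrix.mulVec_mulVec, ← Matrix.star_eq_conjTranspose,
    Matrix.mem_unitaryGroup_iff'.1 hU, Matrix.one_mulVec]

lemma IsUnitVec.mulVec {U : Matrix ι ι ℂ} (hU : U ∈ Matrix.unitaryGroup ι ℂ) {x : ι → ℂ}
    (hx : IsUnitVec x) : IsUnitVec (U *ᵥ x) := by
  rw [IsUnitVec, star_mulVec_dotProduct_mulVec hU, hx]

lemma mem_unitaryGroup_iff_col (R : Matrix ι ι ℂ) :
    R ∈ Matrix.unitaryGroup ι ℂ ↔
      ∀ i j, star (R.col i) ⬝ᵥ R.col j = if i = j then 1 else 0 := by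
  rw [Matrix.mem_unitaryGroup_iff', ← Matrix.ext_iff]
  simp only [Matrix.one_apply, Matrix.mul_apply, Matrix.star_apply, dotProduct, Pi.star_apply,
    Matrix.col_apply]

lemma exists_unitary_col_eq {s : Set ι} {v : ι → ι → ℂ}
    (hv : ∀ i ∈ s, ∀ j ∈ s, star (v i) ⬝ᵥ v j = if i = j then 1 else 0) :
    ∃ R ∈ Matrix.unitaryGroup ι ℂ, ∀ i ∈ s, R.col i = v i := by
  have hinner (x y : ι → ℂ) : inner ℂ (WithLp.toLp 2 x) (WithLp.toLp 2 y) = star x ⬝ᵥ y := by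
    rw [EuclideanSpace.inner_toLp_toLp, dotProduct_comm]
  have horth : Orthonormal ℂ (s.domRestrict fun i ↦ WithLp.toLp 2 (v i)) := by
    rw [orthonormal_iff_ite]
    intro i j
    simp only [Set.domRestrict_apply, hinner, hv i i.2 j j.2, Subtype.ext_iff]
  obtain ⟨b, hb⟩ := horth.exists_orthonormalBasis_extension_of_card_eq (by simp)
  refine ⟨Matrix.of fun i j ↦ b j i, (mem_unitaryGroup_iff_col _).2 fun i j ↦ ?_, fun i hi ↦ ?_⟩
  · rw [← orthonormal_iff_ite.1 b.orthonormal i j]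
    exact (hinner (b i) (b j)).symm
  · ext j
    simp [Matrix.col_apply, hb i hi]

lemma sum_quadForm_col (T : Matrix ι ι ℂ) {R : Matrix ι ι ℂ}
    (hR : R ∈ Matrix.unitaryGroup ι ℂ) : ∑ i, quadForm T (R.col i) = T.trace := by
  have hRR : R * Rᴴ = 1 := Matrix.mem_unitaryGroup_iff.1 hR
  have htrace : (Rᴴ * T * R).trace = T.trace := by
    rw [Matrix.trace_mul_cycle, hRR, Matrix.one_mul]
  rw [← htrace, Matrix.trace]
  refine Finset.sum_congr rfl fun i _ ↦ ?_
  rw [quadForm, Matrix.diag_apply, Matrix.mul_assoc, Matrix.mul_apply]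
  rfl

lemma sum_sq_norm_col_dotProduct {R : Matrix ι ι ℂ} (hR : R ∈ Matrix.unitaryGroup ι ℂ)
    (x : ι → ℂ) : ∑ i, ‖star (R.col i) ⬝ᵥ x‖ ^ 2 = sqNorm x := by
  rw [← Complex.ofReal_inj, ← trace_proj, ← sum_quadForm_col (proj x) hR, Complex.ofReal_sum]
  refine Finset.sum_congr rfl fun i _ ↦ ?_
  rw [quadForm_proj, Matrix.star_dotProduct x, norm_star, Complex.ofReal_pow]

end Unitary

/-! ### Convexity of the numerical range -/

section NumericalRange

lemma exists_conj_mul_eq {a b : ℝ} (ha : 0 ≤ a) (hb : 0 ≤ b) {u : ℂ} (h : a * b = ‖u‖ ^ 2) :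
    ∃ p r : ℂ, ‖p‖ ^ 2 = a ∧ ‖r‖ ^ 2 = b ∧ star p * r = u := by
  obtain ⟨c, hc, hu⟩ : ∃ c : ℂ, ‖c‖ = 1 ∧ c * (‖u‖ : ℂ) = u := RCLike.exists_norm_mul_eq_self u
  have hnorm : √a * √b = ‖u‖ := by rw [← Real.sqrt_mul ha, h, Real.sqrt_sq (norm_nonneg u)]
  refine ⟨(√a : ℝ), c * (√b : ℝ), ?_, ?_, ?_⟩
  · rw [Complex.norm_real, Real.norm_eq_abs, sq_abs, Real.sq_sqrt ha]
  · rw [norm_mul, hc, one_mul, Complex.norm_real, Real.norm_eq_abs, sq_abs, Real.sq_sqrt hb]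
  · rw [← hu, ← hnorm, Complex.star_def, Complex.conj_ofReal]
    push_cast
    ring

lemma exists_pos_add_mul_add_eq {A B : ℝ} {u : ℂ} (hAB : A + B ≤ 0) (h0 : (A, B, u) ≠ 0) :
    ∃ t : ℝ, 0 < t ∧ 0 ≤ A + t ∧ 0 ≤ B + t ∧ (A + t) * (B + t) = ‖u‖ ^ 2 := by
  set s := √(((A - B) / 2) ^ 2 + ‖u‖ ^ 2)
  have hs_sq : s ^ 2 = ((A - B) / 2) ^ 2 + ‖u‖ ^ 2 := Real.sq_sqrt (by positivity)
  have hs_abs : |(A - B) / 2| ≤ s :=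
    Real.abs_le_sqrt (le_add_of_nonneg_right (sq_nonneg ‖u‖))
  obtain ⟨hl, hr⟩ := abs_le.1 hs_abs
  refine ⟨s - (A + B) / 2, ?_, by linarith, by linarith, by linear_combination hs_sq⟩
  by_contra! hle
  have hs0 : s = 0 := by linarith [Real.sqrt_nonneg (((A - B) / 2) ^ 2 + ‖u‖ ^ 2)]
  rw [hs0] at hl hr hs_sq hle
  have hu : u = 0 := by
    rw [← norm_eq_zero, ← sq_eq_zero_iff]
    nlinarith [sq_nonneg ((A - B) / 2), sq_nonneg ‖u‖]
  have hA : A = 0 := by linarith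
  have hB : B = 0 := by linarith
  exact h0 (by rw [hA, hB, hu]; rfl)

-- The triple `(A, B, u)` stands for the Hermitian matrix with diagonal `A, B` and off-diagonal
-- entry `u`. Since `L` has a kernel, the identity can be moved inside its fibre of `L` until it
-- becomes positive semidefinite of rank one.
lemma exists_map_rank_one_eq (L : (ℝ × ℝ × ℂ) →ₗ[ℝ] (ℂ × ℝ)) :
    ∃ p r : ℂ, L (‖p‖ ^ 2, ‖r‖ ^ 2, star p * r) = L (1, 1, 0) := by
  obtain ⟨v, hv, hv0⟩ : ∃ v ∈ LinearMap.ker L, v ≠ 0 := by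
    refine Submodule.exists_mem_ne_zero_of_ne_bot (LinearMap.ker_ne_bot_of_finrank_lt ?_)
    simp [Complex.finrank_real_complex]
  obtain ⟨A, B, u, h0, hAB, hker⟩ : ∃ (A B : ℝ) (u : ℂ), (A, B, u) ≠ 0 ∧ A + B ≤ 0 ∧
      L (A, B, u) = 0 := by
    rcases le_total (v.1 + v.2.1) 0 with hs | hs
    · exact ⟨v.1, v.2.1, v.2.2, hv0, hs, hv⟩
    · refine ⟨-v.1, -v.2.1, -v.2.2, neg_ne_zero.2 hv0, by linarith, ?_⟩
      exact (map_neg L v).trans (by rw [LinearMap.mem_ker.1 hv, neg_zero])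
  obtain ⟨t, ht, hA, hB, hdet⟩ := exists_pos_add_mul_add_eq hAB h0
  obtain ⟨p, r, hp, hr, hpr⟩ := exists_conj_mul_eq (a := (A + t) / t) (b := (B + t) / t)
    (u := u / t) (div_nonneg hA ht.le) (div_nonneg hB ht.le) (by
      rw [norm_div, Complex.norm_real, Real.norm_of_nonneg ht.le, div_mul_div_comm, hdet, div_pow,
        sq t])
  refine ⟨p, r, ?_⟩
  have hsplit : ((A + t) / t, (B + t) / t, u / t) = ((1, 1, 0) : ℝ × ℝ × ℂ) + t⁻¹ • (A, B, u) := by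
    refine Prod.ext ?_ (Prod.ext ?_ ?_)
    · simp; field_simp; ring
    · simp; field_simp; ring
    · simp [div_eq_inv_mul]
  rw [hp, hr, hpr, hsplit, map_add, map_smul, hker, smul_zero, add_zero]

variable {ι κ : Type} [Fintype ι]

-- The Toeplitz–Hausdorff theorem in homogeneous form.
theorem exists_quadForm_eq_add (M : Matrix ι ι ℂ) (C : Submodule ℂ (ι → ℂ)) {x y : ι → ℂ}
    (hx : x ∈ C) (hy : y ∈ C) :
    ∃ w ∈ C, quadForm M w = quadForm M x + quadForm M y ∧ sqNorm w = sqNorm x + sqNorm y := by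
  let L : (ℝ × ℝ × ℂ) →ₗ[ℝ] (ℂ × ℝ) :=
    { toFun v := (v.1 * quadForm M x + v.2.1 * quadForm M y + v.2.2 * (star x ⬝ᵥ (M *ᵥ y)) +
          star v.2.2 * (star y ⬝ᵥ (M *ᵥ x)),
        v.1 * sqNorm x + v.2.1 * sqNorm y + 2 * (v.2.2 * (star x ⬝ᵥ y)).re)
      map_add' v w := by
        ext1
        · simp only [Prod.fst_add, Prod.snd_add, star_add]; push_cast; ring
        · simp only [Prod.fst_add, Prod.snd_add, add_mul, Complex.add_re]; ring
      map_smul' t v := by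
        ext1
        · simp; ring
        · simp; ring }
  obtain ⟨p, r, hL⟩ := exists_map_rank_one_eq L
  refine ⟨p • x + r • y, C.add_mem (C.smul_mem _ hx) (C.smul_mem _ hy), ?_, ?_⟩
  · rw [quadForm_smul_add_smul]
    simpa [L] using congrArg Prod.fst hL
  · rw [sqNorm_smul_add_smul]
    simpa [L] using congrArg Prod.snd hL

lemma exists_quadForm_eq_sum (M : Matrix ι ι ℂ) (C : Submodule ℂ (ι → ℂ)) (s : Finset κ)
    {x : κ → ι → ℂ} (hx : ∀ k ∈ s, x k ∈ C) :
    ∃ w ∈ C, quadForm M w = ∑ k ∈ s, quadForm M (x k) ∧ sqNorm w = ∑ k ∈ s, sqNorm (x k) := by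
  classical
  induction s using Finset.induction_on with
  | empty => exact ⟨0, C.zero_mem, by simp, by simp⟩
  | insert k s hk ih =>
    obtain ⟨w, hw, hq, hn⟩ := ih fun l hl ↦ hx l (Finset.mem_insert_of_mem hl)
    obtain ⟨w', hw', hq', hn'⟩ :=
      exists_quadForm_eq_add M C (hx k (Finset.mem_insert_self k s)) hw
    exact ⟨w', hw', by rw [hq', hq, Finset.sum_insert hk],
      by rw [hn', hn, Finset.sum_insert hk]⟩

end NumericalRange

section ZeroDiagonal

variable {ι : Type} [Fintype ι] [DecidableEq ι]

lemma exists_isUnitVec_quadForm_eq_zero {T R : Matrix ι ι ℂ} (hT : T.trace = 0)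
    (hR : R ∈ Matrix.unitaryGroup ι ℂ) {s : Finset ι} (hs : ∀ i ∈ s, quadForm T (R.col i) = 0)
    (hne : sᶜ.Nonempty) :
    ∃ w, IsUnitVec w ∧ quadForm T w = 0 ∧ ∀ i ∈ s, star (R.col i) ⬝ᵥ w = 0 := by
  have hcol := (mem_unitaryGroup_iff_col R).1 hR
  let C : Submodule ℂ (ι → ℂ) := ⨅ i ∈ s, LinearMap.ker (dotProductEquiv ℂ ι (star (R.col i)))
  have hC (w : ι → ℂ) : w ∈ C ↔ ∀ i ∈ s, star (R.col i) ⬝ᵥ w = 0 := by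
    simp [C, Submodule.mem_iInf, LinearMap.mem_ker]
  obtain ⟨w, hw, hq, hn⟩ := exists_quadForm_eq_sum T C sᶜ (x := R.col) fun j hj ↦
    (hC _).2 fun i hi ↦ by
      rw [hcol, if_neg (ne_of_mem_of_not_mem hi (Finset.mem_compl.1 hj))]
  have hq0 : quadForm T w = 0 := by
    rw [hq, ← hT, ← sum_quadForm_col T hR, ← Finset.sum_add_sum_compl s, Finset.sum_eq_zero hs,
      zero_add]
  have hw0 : w ≠ 0 := by
    rintro rfl
    have hunit (i : ι) : sqNorm (R.col i) = 1 := isUnitVec_iff.1 ((hcol i i).trans (if_pos rfl))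
    simp only [sqNorm_zero, hunit, Finset.sum_const, nsmul_eq_mul, mul_one] at hn
    exact hne.card_pos.ne (by exact_mod_cast hn)
  refine ⟨_, isUnitVec_inv_sqrt_smul hw0, by rw [quadForm_smul, hq0, mul_zero], fun i hi ↦ ?_⟩
  rw [dotProduct_smul, (hC w).1 hw i hi, smul_zero]

lemma exists_unitary_forall_mem_quadForm_col_eq_zero {T : Matrix ι ι ℂ} (hT : T.trace = 0)
    (s : Finset ι) : ∃ R ∈ Matrix.unitaryGroup ι ℂ, ∀ i ∈ s, quadForm T (R.col i) = 0 := by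
  induction s using Finset.induction_on with
  | empty => exact ⟨1, one_mem _, by simp⟩
  | insert k s hk ih =>
    obtain ⟨R, hR, hs⟩ := ih
    have hcol := (mem_unitaryGroup_iff_col R).1 hR
    obtain ⟨w, hw, hwT, horth⟩ :=
      exists_isUnitVec_quadForm_eq_zero hT hR hs ⟨k, Finset.mem_compl.2 hk⟩
    have horth' (i) (hi : i ∈ s) : star w ⬝ᵥ R.col i = 0 := by
      rw [Matrix.star_dotProduct, horth i hi, star_zero]
    have hne (i) (hi : i ∈ s) : i ≠ k := ne_of_mem_of_not_mem hi hk
    obtain ⟨R', hR', hext⟩ := exists_unitary_col_eq (s := ↑(insert k s))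
      (v := Function.update R.col k w) (by
        simp only [Finset.coe_insert, Set.forall_mem_insert, Finset.mem_coe]
        refine ⟨⟨by simpa [IsUnitVec] using hw, fun j hj ↦ ?_⟩, fun i hi ↦ ⟨?_, fun j hj ↦ ?_⟩⟩
        · simp [hne j hj, (hne j hj).symm, horth' j hj]
        · simp [hne i hi, horth i hi]
        · simp [hne i hi, hne j hj, hcol])
    refine ⟨R', hR', fun i hi ↦ ?_⟩
    rw [hext i hi]
    rcases Finset.mem_insert.1 hi with rfl | hi
    · simpa using hwT
    · simpa [hne i hi] using hs i hi

theorem exists_unitary_quadForm_col_eq_zero {T : Matrix ι ι ℂ} (hT : T.trace = 0) :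
    ∃ R ∈ Matrix.unitaryGroup ι ℂ, ∀ i, quadForm T (R.col i) = 0 := by
  simpa using exists_unitary_forall_mem_quadForm_col_eq_zero hT Finset.univ

end ZeroDiagonal

/-! ### Kraus operators of LOCC protocols -/

section Kraus

variable {ι κ : Type} [Fintype ι]

lemma trace_mul_mul_conjTranspose [Fintype κ] (L : Matrix κ ι ℂ) (σ : Matrix ι ι ℂ) :
    (L * σ * Lᴴ).trace = (Lᴴ * L * σ).trace :=
  Matrix.trace_mul_cycle L σ Lᴴ

lemma sum_trace_mul_mul_conjTranspose [DecidableEq ι] {n : ℕ} {μ : Fin n → Type}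
    [∀ k, Fintype (μ k)] {L : (k : Fin n) → Matrix (μ k) ι ℂ} (hL : ∑ k, (L k)ᴴ * L k = 1)
    (σ : Matrix ι ι ℂ) : ∑ k, (L k * σ * (L k)ᴴ).trace = σ.trace := by
  simp only [trace_mul_mul_conjTranspose]
  rw [← Matrix.trace_sum, ← Finset.sum_mul, hL, Matrix.one_mul]

lemma kronecker_conj_kronecker_conj {a b a' b' a'' b'' : ℕ} (A : Matrix (Fin a'') (Fin a') ℂ)
    (B : Matrix (Fin b'') (Fin b') ℂ) (C : Matrix (Fin a') (Fin a) ℂ)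
    (D : Matrix (Fin b') (Fin b) ℂ) (σ : BiOp a b) :
    (A ⊗ₖ B) * ((C ⊗ₖ D) * σ * (C ⊗ₖ D)ᴴ) * (A ⊗ₖ B)ᴴ =
      ((A * C) ⊗ₖ (B * D)) * σ * ((A * C) ⊗ₖ (B * D))ᴴ := by
  rw [Matrix.mul_kronecker_mul, Matrix.conjTranspose_mul]
  simp only [Matrix.mul_assoc]

lemma sum_conjTranspose_mul_kronecker_one {a b n : ℕ} {c : Fin n → ℕ}
    {K : (k : Fin n) → Matrix (Fin (c k)) (Fin a) ℂ} (hK : ∑ k, (K k)ᴴ * K k = 1) :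
    ∑ k, (K k ⊗ₖ (1 : Matrix (Fin b) (Fin b) ℂ))ᴴ * (K k ⊗ₖ (1 : Matrix (Fin b) (Fin b) ℂ)) =
      1 := by
  simp only [Matrix.conjTranspose_kronecker, ← Matrix.mul_kronecker_mul,
    Matrix.conjTranspose_one, Matrix.one_mul]
  rw [← Matrix.one_kronecker_one, ← hK]
  ext p q
  simp [Matrix.sum_apply, Finset.sum_mul]

lemma sum_conjTranspose_mul_one_kronecker {a b n : ℕ} {c : Fin n → ℕ}
    {K : (k : Fin n) → Matrix (Fin (c k)) (Fin b) ℂ} (hK : ∑ k, (K k)ᴴ * K k = 1) :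
    ∑ k, ((1 : Matrix (Fin a) (Fin a) ℂ) ⊗ₖ K k)ᴴ * ((1 : Matrix (Fin a) (Fin a) ℂ) ⊗ₖ K k) =
      1 := by
  simp only [Matrix.conjTranspose_kronecker, ← Matrix.mul_kronecker_mul,
    Matrix.conjTranspose_one, Matrix.one_mul]
  rw [← Matrix.one_kronecker_one, ← hK]
  ext p q
  simp [Matrix.sum_apply, Finset.mul_sum]

end Kraus

section Protocol

variable {O : Type} {a b a' b' : ℕ}

lemma Protocol.exists_kraus (P : Protocol O a' b' a b) (o : O) :
    ∃ (κ : Type) (_ : Fintype κ) (A : κ → Matrix (Fin a') (Fin a) ℂ)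
      (B : κ → Matrix (Fin b') (Fin b) ℂ),
      ∀ σ : BiOp a b, P.run o σ = ∑ k, (A k ⊗ₖ B k) * σ * (A k ⊗ₖ B k)ᴴ := by
  induction P with
  | halt o' =>
    by_cases h : o' = o
    · exact ⟨Unit, inferInstance, fun _ ↦ 1, fun _ ↦ 1, fun σ ↦ by simp [Protocol.run, h]⟩
    · exact ⟨Empty, inferInstance, fun _ ↦ 1, fun _ ↦ 1, fun σ ↦ by simp [Protocol.run, h]⟩
  | alice c K hK next ih =>
    choose κ hκ A B h using ih
    refine ⟨Σ k, κ k, inferInstance, fun l ↦ A l.1 l.2 * K l.1, fun l ↦ B l.1 l.2, fun σ ↦ ?_⟩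
    simp only [Protocol.run, Fintype.sum_sigma, h, kronecker_conj_kronecker_conj, Matrix.mul_one]
  | bob c K hK next ih =>
    choose κ hκ A B h using ih
    refine ⟨Σ k, κ k, inferInstance, fun l ↦ A l.1 l.2, fun l ↦ B l.1 l.2 * K l.1, fun σ ↦ ?_⟩
    simp only [Protocol.run, Fintype.sum_sigma, h, kronecker_conj_kronecker_conj, Matrix.mul_one]

lemma Protocol.sum_trace_run [Fintype O] (P : Protocol O a' b' a b) (σ : BiOp a b) :
    ∑ o, (P.run o σ).trace = σ.trace := by
  induction P with
  | halt o' =>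
    simp only [Protocol.run]
    rw [Finset.sum_eq_single o' (fun o _ h ↦ by simp [h.symm]) (by simp), if_pos rfl]
  | alice c K hK next ih =>
    simp only [Protocol.run, Matrix.trace_sum]
    rw [Finset.sum_comm]
    simp only [ih]
    exact sum_trace_mul_mul_conjTranspose (sum_conjTranspose_mul_kronecker_one hK) σ
  | bob c K hK next ih =>
    simp only [Protocol.run, Matrix.trace_sum]
    rw [Finset.sum_comm]
    simp only [ih]
    exact sum_trace_mul_mul_conjTranspose (sum_conjTranspose_mul_one_kronecker hK) σ

open scoped ComplexOrder in
lemma IsLOCCMeasurement.posSemidef {Ω : Fin 2 → BiOp a b} (h : IsLOCCMeasurement Ω) (i : Fin 2) :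
    (Ω i).PosSemidef := by
  obtain ⟨a', b', P, hP⟩ := h
  obtain ⟨κ, _, A, B, hAB⟩ := P.exists_kraus i
  have hΩ : Ω i = ∑ k, (A k ⊗ₖ B k)ᴴ * (A k ⊗ₖ B k) := by
    rw [Matrix.ext_iff_trace_mul_right]
    intro σ
    simp only [hP, hAB, Matrix.trace_sum, Finset.sum_mul, trace_mul_mul_conjTranspose]
  rw [hΩ]
  exact Matrix.posSemidef_sum _ fun k _ ↦ Matrix.posSemidef_conjTranspose_mul_self _

lemma IsLOCCMeasurement.sum_eq_one {Ω : Fin 2 → BiOp a b} (h : IsLOCCMeasurement Ω) :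
    ∑ i, Ω i = 1 := by
  obtain ⟨a', b', P, hP⟩ := h
  rw [Matrix.ext_iff_trace_mul_right]
  intro σ
  simp only [Finset.sum_mul, Matrix.trace_sum, hP, P.sum_trace_run, Matrix.one_mul]

lemma IsLOCCState.exists_eq_sum {ρ : BiOp a b} (h : IsLOCCState ρ) :
    ∃ (κ : Type) (_ : Fintype κ) (x : κ → Fin a → ℂ) (y : κ → Fin b → ℂ),
      ρ = ∑ k, proj (tensorVec (x k) (y k)) ∧ ∑ k, sqNorm (x k) * sqNorm (y k) = 1 := by
  obtain ⟨P, rfl⟩ := h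
  obtain ⟨κ, hκ, A, B, hAB⟩ := P.exists_kraus ()
  have hrun : P.run () 1 = ∑ k, proj (tensorVec ((A k).col 0) ((B k).col 0)) := by
    rw [hAB]
    refine Finset.sum_congr rfl fun k _ ↦ ?_
    ext p q
    simp [Matrix.mul_apply, proj, tensorVec, Matrix.vecMulVec_apply, Fintype.sum_prod_type]
  have htrace : (P.run () 1).trace = 1 := by simpa using P.sum_trace_run 1
  refine ⟨κ, hκ, fun k ↦ (A k).col 0, fun k ↦ (B k).col 0, hrun, ?_⟩
  rw [hrun, Matrix.trace_sum] at htrace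
  simp only [trace_proj, sqNorm_tensorVec] at htrace
  exact_mod_cast htrace

lemma isLOCCState_proj_tensorVec {x : Fin a → ℂ} {y : Fin b → ℂ} (hx : IsUnitVec x)
    (hy : IsUnitVec y) : IsLOCCState (proj (tensorVec x y)) := by
  have hket {d : ℕ} {v : Fin d → ℂ} (hv : IsUnitVec v) :
      ∑ _k : Fin 1, (Matrix.replicateCol (Fin 1) v)ᴴ * Matrix.replicateCol (Fin 1) v = 1 := by
    ext i j
    rw [Fin.sum_univ_one, Matrix.conjTranspose_replicateCol,
      Matrix.replicateRow_mul_replicateCol_apply, hv, Subsingleton.elim i j, Matrix.one_apply_eq]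
  have hproj {d : ℕ} (v : Fin d → ℂ) :
      Matrix.replicateCol (Fin 1) v * (Matrix.replicateCol (Fin 1) v)ᴴ = proj v := by
    ext i j
    simp [proj, Matrix.mul_apply, Matrix.vecMulVec_apply]
  refine ⟨.alice (fun _ ↦ a) (fun _ ↦ Matrix.replicateCol (Fin 1) x) (hket hx) fun _ ↦
    .bob (fun _ ↦ b) (fun _ ↦ Matrix.replicateCol (Fin 1) y) (hket hy) fun _ ↦ .halt (), ?_⟩
  simp only [Protocol.run, Fin.sum_univ_one, if_true]
  rw [kronecker_conj_kronecker_conj, Matrix.mul_one, Matrix.mul_one, Matrix.one_mul,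
    Matrix.conjTranspose_kronecker, ← Matrix.mul_kronecker_mul, hproj, hproj, proj_kronecker_proj]

end Protocol

section OneWay

variable {d₁ d₂ : ℕ}

/-- The data of a measurement with one-way communication as in `oneWayMeasurement`: orthonormal
bases for Alice and Bob, and a probability distribution on the labels for each pair of outcomes. -/
structure IsOneWayMeasurement (R : Matrix (Fin d₁) (Fin d₁) ℂ)
    (S : Fin d₁ → Matrix (Fin d₂) (Fin d₂) ℂ) (f : Fin d₁ → Fin d₂ → Fin 2 → ℝ) : Prop where
  alice_mem : R ∈ Matrix.unitaryGroup (Fin d₁) ℂ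
  bob_mem : ∀ i, S i ∈ Matrix.unitaryGroup (Fin d₂) ℂ
  nonneg : ∀ i j k, 0 ≤ f i j k
  add_eq_one : ∀ i j, f i j 0 + f i j 1 = 1

variable {R : Matrix (Fin d₁) (Fin d₁) ℂ} {S : Fin d₁ → Matrix (Fin d₂) (Fin d₂) ℂ}
  {f : Fin d₁ → Fin d₂ → Fin 2 → ℝ}

lemma conjTranspose_bra_mul_bra {d : ℕ} (v : Fin d → ℂ) :
    (Matrix.replicateRow (Fin 1) (star v))ᴴ * Matrix.replicateRow (Fin 1) (star v) = proj v := by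
  ext i j
  simp [proj, Matrix.mul_apply, Matrix.vecMulVec_apply]

lemma sum_proj_col {d : ℕ} {T : Matrix (Fin d) (Fin d) ℂ}
    (hT : T ∈ Matrix.unitaryGroup (Fin d) ℂ) : ∑ i, proj (T.col i) = 1 := by
  rw [← Matrix.mem_unitaryGroup_iff.1 hT]
  ext p q
  simp [proj, Matrix.sum_apply, Matrix.mul_apply, Matrix.vecMulVec_apply]

lemma conjTranspose_sqrt_smul_mul_sqrt_smul {ι κ : Type} [Fintype ι] {r : ℝ} (hr : 0 ≤ r)
    (A : Matrix ι κ ℂ) : (((√r : ℝ) : ℂ) • A)ᴴ * (((√r : ℝ) : ℂ) • A) = (r : ℂ) • (Aᴴ * A) := by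
  rw [Matrix.conjTranspose_smul, Matrix.smul_mul, Matrix.mul_smul, smul_smul, Complex.star_def,
    Complex.conj_ofReal, ← Complex.ofReal_mul, Real.mul_self_sqrt hr]

lemma IsOneWayMeasurement.sum_coin_eq_one (h : IsOneWayMeasurement R S f) (i : Fin d₁)
    (j : Fin d₂) :
    ∑ k, (((√(f i j k) : ℝ) : ℂ) • (1 : Matrix (Fin 1) (Fin 1) ℂ))ᴴ *
      (((√(f i j k) : ℝ) : ℂ) • (1 : Matrix (Fin 1) (Fin 1) ℂ)) = 1 := by
  simp only [conjTranspose_sqrt_smul_mul_sqrt_smul (h.nonneg i j _), Matrix.conjTranspose_one,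
    Matrix.mul_one]
  rw [Fin.sum_univ_two, ← add_smul, ← Complex.ofReal_add, h.add_eq_one, Complex.ofReal_one,
    one_smul]

/-- The protocol realizing `oneWayMeasurement R S f`. The final round of Alice acts on a
one-dimensional system and tosses the coin that draws the label. -/
noncomputable def IsOneWayMeasurement.protocol (h : IsOneWayMeasurement R S f) :
    Protocol (Fin 2) 1 1 d₁ d₂ :=
  .alice (fun _ ↦ 1) (fun i ↦ Matrix.replicateRow (Fin 1) (star (R.col i)))
    (by simp only [conjTranspose_bra_mul_bra, sum_proj_col h.alice_mem]) fun i ↦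
  .bob (fun _ ↦ 1) (fun j ↦ Matrix.replicateRow (Fin 1) (star ((S i).col j)))
    (by simp only [conjTranspose_bra_mul_bra, sum_proj_col (h.bob_mem i)]) fun j ↦
  .alice (fun _ ↦ 1) (fun k ↦ ((√(f i j k) : ℝ) : ℂ) • 1) (h.sum_coin_eq_one i j) fun k ↦ .halt k

lemma IsOneWayMeasurement.trace_mul_eq_trace_run (h : IsOneWayMeasurement R S f) (k : Fin 2)
    (σ : BiOp d₁ d₂) : (oneWayMeasurement R S f k * σ).trace = (h.protocol.run k σ).trace := by
  simp only [IsOneWayMeasurement.protocol, Protocol.run, oneWayMeasurement, Finset.sum_mul,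
    Matrix.trace_sum]
  refine Finset.sum_congr rfl fun i _ ↦ Finset.sum_congr rfl fun j _ ↦ ?_
  rw [Finset.sum_eq_single k (fun k' _ hk ↦ by simp [hk]) (by simp), if_pos rfl]
  simp only [kronecker_conj_kronecker_conj, Matrix.one_mul, Matrix.mul_one, Matrix.smul_mul]
  rw [trace_mul_mul_conjTranspose, Matrix.conjTranspose_kronecker, ← Matrix.mul_kronecker_mul,
    conjTranspose_sqrt_smul_mul_sqrt_smul (h.nonneg i j k), conjTranspose_bra_mul_bra,
    conjTranspose_bra_mul_bra, Matrix.smul_kronecker, Matrix.smul_mul]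

lemma IsOneWayMeasurement.isLOCCMeasurement (h : IsOneWayMeasurement R S f) :
    IsLOCCMeasurement (oneWayMeasurement R S f) :=
  ⟨1, 1, h.protocol, h.trace_mul_eq_trace_run⟩

lemma bornProb_oneWayMeasurement_proj (k : Fin 2) (x : Fin d₁ × Fin d₂ → ℂ) :
    bornProb (oneWayMeasurement R S f k) (proj x) =
      ∑ i, ∑ j, f i j k * ‖star (tensorVec (R.col i) ((S i).col j)) ⬝ᵥ x‖ ^ 2 := by
  rw [bornProb, trace_mul_proj, ← Complex.ofReal_re (∑ i, _), oneWayMeasurement]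
  push_cast
  simp only [quadForm_sum_left, quadForm_smul_left, proj_kronecker_proj, quadForm_proj]

end OneWay

section Ancilla

variable {d₁ d₂ : ℕ} (e₁ e₂ : ℕ)

/-- The operator `X ⊗ 𝟙` on the systems and ancillas of Alice and Bob, regrouped according to the
partition `ℂ^d₁ ⊗ ℂ^e₁ : ℂ^d₂ ⊗ ℂ^e₂`. -/
def extendedOp (X : BiOp d₁ d₂) : BiOp (d₁ * e₁) (d₂ * e₂) :=
  Matrix.reindex (regroup d₁ d₂ e₁ e₂) (regroup d₁ d₂ e₁ e₂) (X ⊗ₖ 1)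

lemma tensorId_unitaryChannel {ι κ : Type} [Fintype ι] [Fintype κ] [DecidableEq κ]
    (U : Matrix ι ι ℂ) (σ : Matrix (ι × κ) (ι × κ) ℂ) :
    tensorId (unitaryChannel U) σ = unitaryChannel (U ⊗ₖ 1) σ := by
  ext ⟨p, p'⟩ ⟨q, q'⟩
  simp [tensorId, unitaryChannel, Matrix.mul_apply, Matrix.one_apply, Fintype.sum_prod_type,
    apply_ite (starRingEnd ℂ)]

lemma reindex_unitaryChannel {ι κ : Type} [Fintype ι] [Fintype κ] (e : ι ≃ κ)
    (U : Matrix ι ι ℂ) (ρ : Matrix κ κ ℂ) :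
    Matrix.reindex e e (unitaryChannel U (Matrix.reindex e.symm e.symm ρ)) =
      unitaryChannel (Matrix.reindex e e U) ρ := by
  have hρ : ρ = (ρ.submatrix e e).submatrix e.symm e.symm := by simp
  simp only [unitaryChannel, Matrix.reindex_apply, Equiv.symm_symm,
    Matrix.conjTranspose_submatrix]
  conv_rhs => rw [hρ]
  rw [Matrix.submatrix_mul_equiv, Matrix.submatrix_mul_equiv]

lemma extendedChannel_eq (U : BiOp d₁ d₂) (ρ : BiOp (d₁ * e₁) (d₂ * e₂)) :
    extendedChannel e₁ e₂ U ρ = unitaryChannel (extendedOp e₁ e₂ U) ρ := by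
  rw [extendedChannel, tensorId_unitaryChannel, reindex_unitaryChannel, extendedOp]

lemma conjTranspose_extendedOp_mul (U V : BiOp d₁ d₂) :
    (extendedOp e₁ e₂ V)ᴴ * extendedOp e₁ e₂ U = extendedOp e₁ e₂ (Vᴴ * U) := by
  simp only [extendedOp, Matrix.reindex_apply, Matrix.conjTranspose_submatrix,
    Matrix.submatrix_mul_equiv, Matrix.conjTranspose_kronecker, ← Matrix.mul_kronecker_mul,
    Matrix.conjTranspose_one, Matrix.mul_one]

lemma extendedOp_mem_unitaryGroup {U : BiOp d₁ d₂}
    (hU : U ∈ Matrix.unitaryGroup (Fin d₁ × Fin d₂) ℂ) :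
    extendedOp e₁ e₂ U ∈ Matrix.unitaryGroup (Fin (d₁ * e₁) × Fin (d₂ * e₂)) ℂ := by
  rw [Matrix.mem_unitaryGroup_iff', Matrix.star_eq_conjTranspose, conjTranspose_extendedOp_mul,
    ← Matrix.star_eq_conjTranspose, Matrix.mem_unitaryGroup_iff'.1 hU, extendedOp,
    Matrix.one_kronecker_one, Matrix.reindex_apply, Matrix.submatrix_one_equiv]

lemma quadForm_reindex {ι κ : Type} [Fintype ι] [Fintype κ] (e : ι ≃ κ) (M : Matrix ι ι ℂ)
    (v : κ → ℂ) : quadForm (Matrix.reindex e e M) v = quadForm M (v ∘ e) := by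
  simp only [quadForm, dotProduct, Matrix.mulVec, Matrix.reindex_apply, Matrix.submatrix_apply,
    ← e.sum_comp, Equiv.symm_apply_apply, Pi.star_apply, Function.comp_apply]

lemma quadForm_kronecker_one {ι κ : Type} [Fintype ι] [Fintype κ] [DecidableEq κ]
    (X : Matrix ι ι ℂ) (v : ι × κ → ℂ) :
    quadForm (X ⊗ₖ (1 : Matrix κ κ ℂ)) v = ∑ k, quadForm X fun i ↦ v (i, k) := by
  simp only [quadForm, dotProduct, Matrix.mulVec, Matrix.kroneckerMap_apply,
    Fintype.sum_prod_type, Matrix.one_apply]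
  rw [Finset.sum_comm]
  simp

lemma quadForm_extendedOp_tensorVec (X : BiOp d₁ d₂) (x : Fin (d₁ * e₁) → ℂ)
    (y : Fin (d₂ * e₂) → ℂ) :
    quadForm (extendedOp e₁ e₂ X) (tensorVec x y) =
      ∑ s, ∑ t, quadForm X (tensorVec (fun i ↦ x (finProdFinEquiv (i, s)))
        (fun j ↦ y (finProdFinEquiv (j, t)))) := by
  rw [extendedOp, quadForm_reindex, quadForm_kronecker_one, Fintype.sum_prod_type]
  rfl

lemma sqNorm_eq_sum_sqNorm_finProdFinEquiv {d e : ℕ} (x : Fin (d * e) → ℂ) :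
    sqNorm x = ∑ s, sqNorm fun i ↦ x (finProdFinEquiv (i, s)) := by
  simp only [sqNorm]
  rw [← finProdFinEquiv.sum_comp, Fintype.sum_prod_type, Finset.sum_comm]

end Ancilla

/-! ### The product numerical range -/

section ProductNumericalRange

variable {a b : ℕ}

lemma isCompact_setOf_isUnitVec (ι : Type) [Fintype ι] : IsCompact {x : ι → ℂ | IsUnitVec x} := by
  refine Metric.isCompact_of_isClosed_isBounded ?_ ?_
  · exact isClosed_eq (by unfold dotProduct; fun_prop) continuous_const
  · refine (Metric.isBounded_closedBall (x := 0) (r := 1)).subset fun x hx ↦ ?_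
    rw [mem_closedBall_zero_iff, pi_norm_le_iff_of_nonneg zero_le_one]
    intro i
    rw [← sq_le_one_iff₀ (norm_nonneg _), ← isUnitVec_iff.1 hx]
    exact Finset.single_le_sum (f := fun i ↦ ‖x i‖ ^ 2) (fun _ _ ↦ sq_nonneg _) (Finset.mem_univ i)

lemma isCompact_productNumericalRange (X : BiOp a b) : IsCompact (productNumericalRange X) := by
  have himage : productNumericalRange X = (fun p : (Fin a → ℂ) × (Fin b → ℂ) ↦
      quadForm X (tensorVec p.1 p.2)) '' ({x | IsUnitVec x} ×ˢ {y | IsUnitVec y}) := by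
    ext w
    simp [productNumericalRange, and_assoc, eq_comm]
  rw [himage]
  refine ((isCompact_setOf_isUnitVec _).prod (isCompact_setOf_isUnitVec _)).image ?_
  unfold quadForm tensorVec dotProduct Matrix.mulVec dotProduct
  fun_prop

lemma isUnitVec_single {n : ℕ} (i : Fin n) : IsUnitVec (Pi.single i 1 : Fin n → ℂ) := by
  simp [IsUnitVec]

theorem isLeast_distToZero (ha : 1 ≤ a) (hb : 1 ≤ b) (X : BiOp a b) :
    IsLeast ((fun w : ℂ ↦ ‖w‖) '' productNumericalRange X) (distToZero X) := by
  have hne : (productNumericalRange X).Nonempty :=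
    ⟨_, _, _, isUnitVec_single ⟨0, ha⟩, isUnitVec_single ⟨0, hb⟩, rfl⟩
  constructor
  · obtain ⟨w, hw, h⟩ := (isCompact_productNumericalRange X).exists_infDist_eq_dist hne 0
    exact ⟨w, hw, by rw [distToZero, h, dist_zero_left]⟩
  · rintro _ ⟨w, hw, rfl⟩
    simpa [distToZero] using Metric.infDist_le_dist_of_mem (x := (0 : ℂ)) hw

lemma tensorVec_smul_smul (c d : ℂ) (x : Fin a → ℂ) (y : Fin b → ℂ) :
    tensorVec (c • x) (d • y) = (c * d) • tensorVec x y := by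
  ext p
  exact mul_mul_mul_comm c (x p.1) d (y p.2)

lemma distToZero_mul_le (X : BiOp a b) (x : Fin a → ℂ) (y : Fin b → ℂ) :
    distToZero X * (sqNorm x * sqNorm y) ≤ ‖quadForm X (tensorVec x y)‖ := by
  by_cases hx : x = 0
  · simp [hx]
  by_cases hy : y = 0
  · simp [hy]
  have hpos {n : ℕ} {v : Fin n → ℂ} (hv : v ≠ 0) : 0 < sqNorm v :=
    (sqNorm_nonneg v).lt_of_ne' (sqNorm_eq_zero.not.2 hv)
  have hle : distToZero X ≤ _ := Metric.infDist_le_dist_of_mem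
    ⟨_, _, isUnitVec_inv_sqrt_smul hx, isUnitVec_inv_sqrt_smul hy, rfl⟩
  have hnorm : ‖((√(sqNorm x) : ℝ) : ℂ)⁻¹ * ((√(sqNorm y) : ℝ) : ℂ)⁻¹‖ ^ 2 =
      (sqNorm x * sqNorm y)⁻¹ := by
    rw [← mul_inv, ← Complex.ofReal_mul, norm_inv, Complex.norm_real, inv_pow, Real.norm_eq_abs,
      sq_abs, mul_pow, Real.sq_sqrt (sqNorm_nonneg x), Real.sq_sqrt (sqNorm_nonneg y)]
  rw [dist_zero_left, tensorVec_smul_smul, quadForm_smul, norm_mul, ← Complex.ofReal_pow, hnorm,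
    Complex.norm_real, Real.norm_of_nonneg (inv_nonneg.2 (mul_pos (hpos hx) (hpos hy)).le)] at hle
  rwa [← le_div_iff₀ (mul_pos (hpos hx) (hpos hy)), div_eq_inv_mul]

lemma exists_quadForm_tensorVec_left (X : BiOp a b) (y : Fin b → ℂ) :
    ∃ M : Matrix (Fin a) (Fin a) ℂ, ∀ x, quadForm M x = quadForm X (tensorVec x y) := by
  let T : Matrix (Fin a × Fin b) (Fin a) ℂ := Matrix.of fun p i ↦ if p.1 = i then y p.2 else 0
  have hT (x : Fin a → ℂ) : T *ᵥ x = tensorVec x y := by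
    ext p
    simp [T, Matrix.mulVec, dotProduct, tensorVec, mul_comm]
  exact ⟨Tᴴ * X * T, fun x ↦ by rw [quadForm_conjTranspose_mul_mul, hT]⟩

lemma exists_quadForm_tensorVec_right (X : BiOp a b) (x : Fin a → ℂ) :
    ∃ M : Matrix (Fin b) (Fin b) ℂ, ∀ y, quadForm M y = quadForm X (tensorVec x y) := by
  let T : Matrix (Fin a × Fin b) (Fin b) ℂ := Matrix.of fun p j ↦ if p.2 = j then x p.1 else 0
  have hT (y : Fin b → ℂ) : T *ᵥ y = tensorVec x y := by
    ext p
    simp [T, Matrix.mulVec, dotProduct, tensorVec]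
  exact ⟨Tᴴ * X * T, fun y ↦ by rw [quadForm_conjTranspose_mul_mul, hT]⟩

lemma mul_sum_sqNorm_le_norm_sum_quadForm {ι κ : Type} [Fintype ι] [Fintype κ] {z : ℝ}
    {M : Matrix ι ι ℂ} (h : ∀ x, z * sqNorm x ≤ ‖quadForm M x‖) (x : κ → ι → ℂ) :
    z * ∑ k, sqNorm (x k) ≤ ‖∑ k, quadForm M (x k)‖ := by
  obtain ⟨w, -, hquad, hnorm⟩ :=
    exists_quadForm_eq_sum M ⊤ Finset.univ (x := x) fun _ _ ↦ Submodule.mem_top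
  rw [← hquad, ← hnorm]
  exact h w

-- Toeplitz–Hausdorff convexity is used on Bob's side for each fixed vector of Alice, and then on
-- Alice's side for the sum of the resulting forms.
theorem distToZero_mul_sum_le {κ μ : Type} [Fintype κ] [Fintype μ] (X : BiOp a b)
    (x : κ → Fin a → ℂ) (y : μ → Fin b → ℂ) :
    distToZero X * ((∑ s, sqNorm (x s)) * ∑ t, sqNorm (y t)) ≤
      ‖∑ s, ∑ t, quadForm X (tensorVec (x s) (y t))‖ := by
  choose M hM using fun t ↦ exists_quadForm_tensorVec_left X (y t)
  have hsum (x : Fin a → ℂ) : quadForm (∑ t, M t) x = ∑ t, quadForm X (tensorVec x (y t)) := by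
    simp only [quadForm_sum_left, hM]
  have hbob (x : Fin a → ℂ) :
      distToZero X * (∑ t, sqNorm (y t)) * sqNorm x ≤ ‖quadForm (∑ t, M t) x‖ := by
    obtain ⟨N, hN⟩ := exists_quadForm_tensorVec_right X x
    have hle := mul_sum_sqNorm_le_norm_sum_quadForm (z := distToZero X * sqNorm x) (M := N)
      (fun y ↦ by rw [hN, mul_assoc]; exact distToZero_mul_le X x y) y
    simpa only [hsum, hN, mul_right_comm] using hle
  have halice := mul_sum_sqNorm_le_norm_sum_quadForm hbob x
  simp only [hsum] at halice
  rwa [mul_comm (∑ s, _), ← mul_assoc]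

theorem distToZero_mul_le_extendedOp {d₁ d₂ : ℕ} (e₁ e₂ : ℕ) (X : BiOp d₁ d₂)
    (x : Fin (d₁ * e₁) → ℂ) (y : Fin (d₂ * e₂) → ℂ) :
    distToZero X * (sqNorm x * sqNorm y) ≤
      ‖quadForm (extendedOp e₁ e₂ X) (tensorVec x y)‖ := by
  rw [quadForm_extendedOp_tensorVec, sqNorm_eq_sum_sqNorm_finProdFinEquiv x,
    sqNorm_eq_sum_sqNorm_finProdFinEquiv y]
  exact distToZero_mul_sum_le X _ _

end ProductNumericalRange

/-! ### Converse: the error of an arbitrary test -/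

section Overlap

variable {ι κ μ : Type} [Fintype ι]

lemma norm_star_dotProduct_le (x y : ι → ℂ) : ‖star x ⬝ᵥ y‖ ≤ √(sqNorm x) * √(sqNorm y) := by
  rw [dotProduct_comm, ← EuclideanSpace.inner_toLp_toLp]
  exact (norm_inner_le_norm _ _).trans_eq
    (by rw [EuclideanSpace.norm_eq, EuclideanSpace.norm_eq]; rfl)

open scoped ComplexOrder in
lemma quadForm_re_nonneg {E : Matrix ι ι ℂ} (hE : E.PosSemidef) (x : ι → ℂ) :
    0 ≤ (quadForm E x).re :=
  (Complex.le_def.1 (hE.dotProduct_mulVec_nonneg x)).1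

open scoped ComplexOrder MatrixOrder in
lemma norm_star_dotProduct_mulVec_le {E : Matrix ι ι ℂ} (hE : E.PosSemidef) (x y : ι → ℂ) :
    ‖star x ⬝ᵥ (E *ᵥ y)‖ ≤ √(quadForm E x).re * √(quadForm E y).re := by
  classical
  obtain ⟨B, rfl⟩ : ∃ B : Matrix ι ι ℂ, E = Bᴴ * B :=
    CStarAlgebra.nonneg_iff_eq_star_mul_self.1 (Matrix.nonneg_iff_posSemidef.2 hE)
  simp only [quadForm_conjTranspose_mul, star_dotProduct_self, Complex.ofReal_re]
  rw [← Matrix.mulVec_mulVec, ← star_mulVec_dotProduct]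
  exact norm_star_dotProduct_le _ _

lemma bornProb_sum_proj [Fintype κ] (E : Matrix ι ι ℂ) (x : κ → ι → ℂ) :
    bornProb E (∑ l, proj (x l)) = ∑ l, (quadForm E (x l)).re := by
  simp only [bornProb, Finset.mul_sum, Matrix.trace_sum, trace_mul_proj, Complex.re_sum]

lemma unitaryChannel_sum_proj [Fintype κ] (U : Matrix ι ι ℂ) (x : κ → ι → ℂ) :
    unitaryChannel U (∑ l, proj (x l)) = ∑ l, proj (U *ᵥ x l) := by
  simp only [unitaryChannel, Finset.mul_sum, Finset.sum_mul, mul_proj_mul_conjTranspose]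

lemma unitaryChannel_proj (U : Matrix ι ι ℂ) (x : ι → ℂ) :
    unitaryChannel U (proj x) = proj (U *ᵥ x) :=
  mul_proj_mul_conjTranspose U x

variable [DecidableEq ι]

lemma trace_unitaryChannel {U : Matrix ι ι ℂ} (hU : U ∈ Matrix.unitaryGroup ι ℂ)
    (ρ : Matrix ι ι ℂ) : (unitaryChannel U ρ).trace = ρ.trace := by
  rw [unitaryChannel, trace_mul_mul_conjTranspose, ← Matrix.star_eq_conjTranspose,
    Matrix.mem_unitaryGroup_iff'.1 hU, Matrix.one_mul]

lemma sum_bornProb [Fintype μ] {E : μ → Matrix ι ι ℂ} (hE : ∑ k, E k = 1) (σ : Matrix ι ι ℂ) :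
    ∑ k, bornProb (E k) σ = σ.trace.re := by
  simp only [bornProb]
  rw [← Complex.re_sum, ← Matrix.trace_sum, ← Finset.sum_mul, hE, Matrix.one_mul]

open scoped ComplexOrder in
theorem sum_norm_star_dotProduct_le_sum_sqrt_bornProb [Fintype κ] [Fintype μ]
    {E : μ → Matrix ι ι ℂ} (hpos : ∀ k, (E k).PosSemidef) (hE : ∑ k, E k = 1) (x y : κ → ι → ℂ) :
    ∑ l, ‖star (x l) ⬝ᵥ y l‖ ≤
      ∑ k, √(bornProb (E k) (∑ l, proj (x l))) * √(bornProb (E k) (∑ l, proj (y l))) := by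
  have hpure (l : κ) :
      ‖star (x l) ⬝ᵥ y l‖ ≤ ∑ k, √(quadForm (E k) (x l)).re * √(quadForm (E k) (y l)).re := by
    have hsplit : star (x l) ⬝ᵥ y l = ∑ k, star (x l) ⬝ᵥ (E k *ᵥ y l) := by
      rw [← dotProduct_sum, ← Matrix.sum_mulVec, hE, Matrix.one_mulVec]
    rw [hsplit]
    exact (norm_sum_le _ _).trans
      (Finset.sum_le_sum fun k _ ↦ norm_star_dotProduct_mulVec_le (hpos k) _ _)
  simp only [bornProb_sum_proj]
  calc ∑ l, ‖star (x l) ⬝ᵥ y l‖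
      ≤ ∑ l, ∑ k, √(quadForm (E k) (x l)).re * √(quadForm (E k) (y l)).re :=
        Finset.sum_le_sum fun l _ ↦ hpure l
    _ = ∑ k, ∑ l, √(quadForm (E k) (x l)).re * √(quadForm (E k) (y l)).re := Finset.sum_comm
    _ ≤ _ := Finset.sum_le_sum fun k _ ↦ Real.sum_sqrt_mul_sqrt_le _
        (fun _ ↦ quadForm_re_nonneg (hpos k) _) fun _ ↦ quadForm_re_nonneg (hpos k) _

end Overlap

section OptimalError

open Real

variable {z δ : ℝ}

lemma optimalError_eq_cos_sq (hzδ : √δ < z) (hδ : 0 ≤ δ) (hz : z ≤ 1) :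
    optimalError z δ = cos (arccos z + arcsin √δ) ^ 2 := by
  have hz0 : 0 ≤ z := (sqrt_nonneg δ).trans hzδ.le
  rw [optimalError, if_neg hzδ.not_ge, cos_add, cos_arccos (by linarith) hz, sin_arccos,
    cos_arcsin, sq_sqrt hδ, sin_arcsin (by linarith [sqrt_nonneg δ]) (hzδ.le.trans hz)]

lemma cos_arccos_sqrt_sub_arcsin_sqrt {α β : ℝ} (hα : 0 ≤ α) (hα1 : α ≤ 1) (hβ : 0 ≤ β)
    (hβ1 : β ≤ 1) :
    cos (arccos √β - arcsin √α) = √β * √(1 - α) + √(1 - β) * √α := by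
  rw [cos_sub, cos_arccos (by linarith [sqrt_nonneg β]) (sqrt_le_one.2 hβ1), sin_arccos,
    cos_arcsin, sq_sqrt hα, sq_sqrt hβ,
    sin_arcsin (by linarith [sqrt_nonneg α]) (sqrt_le_one.2 hα1)]

lemma abs_arccos_sub_arcsin_le_arccos {p q : ℝ} (hq : 0 ≤ q)
    (h : z ≤ cos (arccos p - arcsin q)) : |arccos p - arcsin q| ≤ arccos z := by
  have hpi : |arccos p - arcsin q| ≤ π := by
    rw [abs_le]
    constructor <;> linarith [arccos_nonneg p, arccos_le_pi p, arcsin_le_pi_div_two q,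
      arcsin_nonneg.2 hq, pi_pos]
  rw [← arccos_cos (abs_nonneg (arccos p - arcsin q)) hpi, cos_abs]
  exact antitone_arccos h

-- With `√β = cos B`, `√α = sin A`, `z = cos Z` and `√δ = sin D`, the hypothesis on `z` says that
-- `|B - A| ≤ Z`, while the optimal error is `cos² (Z + D)` as long as `Z + D < π / 2`.
theorem optimalError_le {α β : ℝ} (hα : 0 ≤ α) (hβ : 0 ≤ β) (hβ1 : β ≤ 1) (hαδ : α ≤ δ)
    (hδ1 : δ ≤ 1) (h : z ≤ √β * √(1 - α) + √(1 - β) * √α) : optimalError z δ ≤ β := by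
  rcases le_or_gt z √δ with hzδ | hzδ
  · rwa [optimalError, if_pos hzδ]
  rw [← cos_arccos_sqrt_sub_arcsin_sqrt hα (hαδ.trans hδ1) hβ hβ1] at h
  have hupper : arccos √β ≤ arccos z + arcsin √δ := by
    have hangle := (abs_le.1 (abs_arccos_sub_arcsin_le_arccos (sqrt_nonneg α) h)).2
    linarith [monotone_arcsin (sqrt_le_sqrt hαδ)]
  have hacute : arccos z + arcsin √δ ≤ π / 2 := by
    linarith [monotone_arcsin hzδ.le, arccos_eq_pi_div_two_sub_arcsin z]
  have hcos : cos (arccos z + arcsin √δ) ≤ √β := by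
    rw [← cos_arccos (x := √β) (by linarith [sqrt_nonneg β]) (sqrt_le_one.2 hβ1)]
    exact cos_le_cos_of_nonneg_of_le_pi (arccos_nonneg _) (by linarith [pi_pos]) hupper
  have hcos_nonneg : 0 ≤ cos (arccos z + arcsin √δ) :=
    cos_nonneg_of_mem_Icc ⟨by linarith [arccos_nonneg √β, pi_pos], hacute⟩
  rw [optimalError_eq_cos_sq hzδ (hα.trans hαδ) (h.trans (cos_le_one _)), ← sq_sqrt hβ]
  exact pow_le_pow_left₀ hcos_nonneg hcos 2

end OptimalError

section Converse

open scoped ComplexOrder in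
lemma bornProb_nonneg_of_posSemidef {ι κ : Type} [Fintype ι] [Fintype κ] {E : Matrix ι ι ℂ}
    (hE : E.PosSemidef) (x : κ → ι → ℂ) : 0 ≤ bornProb E (∑ l, proj (x l)) := by
  rw [bornProb_sum_proj]
  exact Finset.sum_nonneg fun l _ ↦ quadForm_re_nonneg hE (x l)

variable {d₁ d₂ : ℕ} {U V : BiOp d₁ d₂}

lemma distToZero_le_sum_norm_extendedOp {e₁ e₂ : ℕ} {κ : Type} [Fintype κ]
    {x : κ → Fin (d₁ * e₁) → ℂ} {y : κ → Fin (d₂ * e₂) → ℂ}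
    (hxy : ∑ l, sqNorm (x l) * sqNorm (y l) = 1) :
    distToZero (Vᴴ * U) ≤ ∑ l, ‖star (extendedOp e₁ e₂ V *ᵥ tensorVec (x l) (y l)) ⬝ᵥ
      (extendedOp e₁ e₂ U *ᵥ tensorVec (x l) (y l))‖ := by
  calc distToZero (Vᴴ * U) = ∑ l, distToZero (Vᴴ * U) * (sqNorm (x l) * sqNorm (y l)) := by
        rw [← Finset.mul_sum, hxy, mul_one]
    _ ≤ _ := Finset.sum_le_sum fun l _ ↦ by
        rw [← quadForm_conjTranspose_mul, conjTranspose_extendedOp_mul]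
        exact distToZero_mul_le_extendedOp e₁ e₂ _ _ _

theorem optimalError_le_of_mem_typeIIErrors (hU : U ∈ Matrix.unitaryGroup (Fin d₁ × Fin d₂) ℂ)
    (hV : V ∈ Matrix.unitaryGroup (Fin d₁ × Fin d₂) ℂ) {δ : ℝ} (hδ : δ ≤ 1) {p : ℝ}
    (hp : p ∈ typeIIErrors U V δ) : optimalError (distToZero (Vᴴ * U)) δ ≤ p := by
  obtain ⟨e₁, e₂, ρ, Ω, hρ, hΩ, hI, rfl⟩ := hp
  obtain ⟨κ, _, x, y, rfl, hxy⟩ := hρ.exists_eq_sum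
  have htotal {W : BiOp d₁ d₂} (hW : W ∈ Matrix.unitaryGroup (Fin d₁ × Fin d₂) ℂ) :
      bornProb (Ω 0) (extendedChannel e₁ e₂ W (∑ l, proj (tensorVec (x l) (y l)))) +
        bornProb (Ω 1) (extendedChannel e₁ e₂ W (∑ l, proj (tensorVec (x l) (y l)))) = 1 := by
    rw [← Fin.sum_univ_two fun k ↦ bornProb (Ω k) _, sum_bornProb hΩ.sum_eq_one,
      extendedChannel_eq, trace_unitaryChannel (extendedOp_mem_unitaryGroup e₁ e₂ hW),
      Matrix.trace_sum]
    simp only [trace_proj, sqNorm_tensorVec, ← Complex.ofReal_sum, hxy, Complex.ofReal_re]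
  have hnonneg (k : Fin 2) (W : BiOp d₁ d₂) :
      0 ≤ bornProb (Ω k) (extendedChannel e₁ e₂ W (∑ l, proj (tensorVec (x l) (y l)))) := by
    rw [extendedChannel_eq, unitaryChannel_sum_proj]
    exact bornProb_nonneg_of_posSemidef (hΩ.posSemidef k) _
  have hoverlap := (distToZero_le_sum_norm_extendedOp (U := U) (V := V) hxy).trans
    (sum_norm_star_dotProduct_le_sum_sqrt_bornProb hΩ.posSemidef hΩ.sum_eq_one _ _)
  simp only [← unitaryChannel_sum_proj, ← extendedChannel_eq, Fin.sum_univ_two] at hoverlap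
  refine optimalError_le (hnonneg 1 U) (hnonneg 0 V) ?_ hI hδ ?_
  · linarith [htotal hV, hnonneg 1 V]
  · rwa [eq_sub_of_add_eq (htotal hU), eq_sub_of_add_eq' (htotal hV)] at hoverlap

end Converse

/-! ### Perfect discrimination of two orthogonal vectors -/

section Discrimination

lemma exists_unitary_eq_smul_col {ι : Type} [Fintype ι] [DecidableEq ι] (x : ι → ℂ) (i : ι) :
    ∃ S ∈ Matrix.unitaryGroup ι ℂ, ∃ c : ℂ, x = c • S.col i := by
  rcases eq_or_ne x 0 with rfl | hx
  · exact ⟨1, one_mem _, 0, (zero_smul ℂ _).symm⟩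
  obtain ⟨S, hS, hcol⟩ := exists_unitary_col_eq (s := {i})
    (v := fun _ ↦ ((√(sqNorm x) : ℝ) : ℂ)⁻¹ • x) (by
      simpa [IsUnitVec] using isUnitVec_inv_sqrt_smul hx)
  have hne : ((√(sqNorm x) : ℝ) : ℂ) ≠ 0 := by
    simpa [Real.sqrt_eq_zero (sqNorm_nonneg x), sqNorm_eq_zero] using hx
  exact ⟨S, hS, _, by rw [hcol i rfl, smul_inv_smul₀ hne]⟩

lemma exists_unitary_col_orthogonal {ι : Type} [Fintype ι] [DecidableEq ι] {i₀ i₁ : ι}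
    (hi : i₀ ≠ i₁) {u v : ι → ℂ} (huv : star u ⬝ᵥ v = 0) :
    ∃ S ∈ Matrix.unitaryGroup ι ℂ, star (S.col i₀) ⬝ᵥ v = 0 ∧
      ∀ i ≠ i₀, star (S.col i) ⬝ᵥ u = 0 := by
  have horth {S : Matrix ι ι ℂ} (hS : S ∈ Matrix.unitaryGroup ι ℂ) {i j : ι} (hij : i ≠ j)
      (c : ℂ) : star (S.col i) ⬝ᵥ (c • S.col j) = 0 := by
    rw [dotProduct_smul, (mem_unitaryGroup_iff_col S).1 hS, if_neg hij, smul_zero]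
  rcases eq_or_ne u 0 with rfl | hu
  · obtain ⟨S, hS, c, rfl⟩ := exists_unitary_eq_smul_col v i₁
    exact ⟨S, hS, horth hS hi c, fun _ _ ↦ dotProduct_zero _⟩
  · obtain ⟨S, hS, c, rfl⟩ := exists_unitary_eq_smul_col u i₀
    refine ⟨S, hS, ?_, fun i hi ↦ horth hS hi c⟩
    rw [star_smul, smul_dotProduct, smul_eq_mul] at huv
    exact (mul_eq_zero.1 huv).resolve_left (star_ne_zero.2 (left_ne_zero_of_smul hu))

variable {a b : ℕ}

/-- The vector `(⟨r| ⊗ 𝟙)|x⟩`: Bob's unnormalized state after Alice has found `r`. -/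
def partialInner (r : Fin a → ℂ) (x : Fin a × Fin b → ℂ) : Fin b → ℂ :=
  fun j ↦ star r ⬝ᵥ fun i ↦ x (i, j)

lemma star_tensorVec_dotProduct (r : Fin a → ℂ) (s : Fin b → ℂ) (x : Fin a × Fin b → ℂ) :
    star (tensorVec r s) ⬝ᵥ x = star s ⬝ᵥ partialInner r x := by
  simp only [dotProduct, tensorVec, partialInner, Fintype.sum_prod_type_right, Finset.mul_sum,
    Pi.star_apply, star_mul', mul_assoc, mul_left_comm]

lemma exists_unitary_partialInner_orthogonal {x y : Fin a × Fin b → ℂ} (h : star x ⬝ᵥ y = 0) :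
    ∃ R ∈ Matrix.unitaryGroup (Fin a) ℂ, ∀ i,
      star (partialInner (R.col i) x) ⬝ᵥ partialInner (R.col i) y = 0 := by
  let T : Matrix (Fin a) (Fin a) ℂ :=
    ∑ j, Matrix.vecMulVec (fun i ↦ y (i, j)) (star fun i ↦ x (i, j))
  have htrace : T.trace = 0 := by
    rw [← h]
    simp only [T, Matrix.trace_sum, Matrix.trace_vecMulVec, dotProduct,
      Fintype.sum_prod_type_right, Pi.star_apply, mul_comm]
  have hquad (r : Fin a → ℂ) : quadForm T r = star (partialInner r x) ⬝ᵥ partialInner r y := by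
    simp only [T, quadForm_sum_left]
    refine Finset.sum_congr rfl fun j _ ↦ ?_
    rw [quadForm, Matrix.vecMulVec_mulVec, dotProduct_smul, Matrix.star_dotProduct]
    exact mul_comm _ _
  obtain ⟨R, hR, hzero⟩ := exists_unitary_quadForm_col_eq_zero htrace
  exact ⟨R, hR, fun i ↦ by rw [← hquad, hzero]⟩

/-- Measuring in the orthonormal bases of columns of `R` (Alice) and, after Alice's outcome `i`,
of `S i` (Bob), the label `g i j` tells with certainty which of the vectors `x` (label `0`) and
`y` (label `1`) the system was in. -/
structure IsPerfectDiscrimination (R : Matrix (Fin a) (Fin a) ℂ)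
    (S : Fin a → Matrix (Fin b) (Fin b) ℂ) (g : Fin a → Fin b → Fin 2)
    (x y : Fin a × Fin b → ℂ) : Prop where
  alice_mem : R ∈ Matrix.unitaryGroup (Fin a) ℂ
  bob_mem : ∀ i, S i ∈ Matrix.unitaryGroup (Fin b) ℂ
  right_eq_zero : ∀ i j, g i j = 0 → star (tensorVec (R.col i) ((S i).col j)) ⬝ᵥ y = 0
  left_eq_zero : ∀ i j, g i j = 1 → star (tensorVec (R.col i) ((S i).col j)) ⬝ᵥ x = 0

variable {x y : Fin a × Fin b → ℂ}

lemma exists_isPerfectDiscrimination_of_nontrivial_right [Nontrivial (Fin b)]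
    (h : star x ⬝ᵥ y = 0) :
    ∃ R S, ∃ g : Fin b → Fin 2, IsPerfectDiscrimination R S (fun _ ↦ g) x y := by
  obtain ⟨j₀, j₁, hj⟩ := exists_pair_ne (Fin b)
  obtain ⟨R, hR, horth⟩ := exists_unitary_partialInner_orthogonal h
  choose S hS hy hx using fun i ↦ exists_unitary_col_orthogonal hj (horth i)
  refine ⟨R, S, fun j ↦ if j = j₀ then 0 else 1, hR, hS, fun i j hg ↦ ?_, fun i j hg ↦ ?_⟩
  · rw [star_tensorVec_dotProduct, (show j = j₀ by simpa using hg), hy]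
  · rw [star_tensorVec_dotProduct, hx i j (by simpa using hg)]

lemma exists_isPerfectDiscrimination_of_nontrivial_left [Nontrivial (Fin a)]
    {x y : Fin a × Fin 1 → ℂ} (h : star x ⬝ᵥ y = 0) :
    ∃ R S, ∃ g : Fin a → Fin 2, IsPerfectDiscrimination R S (fun i _ ↦ g i) x y := by
  obtain ⟨i₀, i₁, hi⟩ := exists_pair_ne (Fin a)
  have hbob (r : Fin a → ℂ) (j : Fin 1) (v : Fin a × Fin 1 → ℂ) :
      star (tensorVec r ((1 : Matrix (Fin 1) (Fin 1) ℂ).col j)) ⬝ᵥ v =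
        star r ⬝ᵥ fun i ↦ v (i, 0) := by
    rw [star_tensorVec_dotProduct]
    simp [dotProduct, partialInner, Subsingleton.elim j 0]
  obtain ⟨R, hR, hy, hx⟩ := exists_unitary_col_orthogonal hi
    (u := fun i ↦ x (i, 0)) (v := fun i ↦ y (i, 0))
    (by simpa [dotProduct, Fintype.sum_prod_type] using h)
  refine ⟨R, fun _ ↦ 1, fun i ↦ if i = i₀ then 0 else 1, hR, fun _ ↦ one_mem _,
    fun i j hg ↦ ?_, fun i j hg ↦ ?_⟩
  · rw [hbob, (show i = i₀ by simpa using hg), hy]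
  · rw [hbob, hx i (by simpa using hg)]

theorem exists_isPerfectDiscrimination (hab : 2 ≤ a * b) (h : star x ⬝ᵥ y = 0) :
    ∃ R S g, IsPerfectDiscrimination R S g x y ∧ (2 ≤ b → ∀ i i', g i = g i') := by
  rcases le_or_gt 2 b with hb | hb
  · have : Nontrivial (Fin b) := Fin.nontrivial_iff_two_le.2 hb
    obtain ⟨R, S, g, hd⟩ := exists_isPerfectDiscrimination_of_nontrivial_right h
    exact ⟨R, S, fun _ ↦ g, hd, fun _ _ _ ↦ rfl⟩
  · obtain rfl : b = 1 := by
      have : 0 < b := Nat.pos_of_mul_pos_left (by omega : 0 < a * b)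
      omega
    have : Nontrivial (Fin a) := Fin.nontrivial_iff_two_le.2 (by omega)
    obtain ⟨R, S, g, hd⟩ := exists_isPerfectDiscrimination_of_nontrivial_left h
    exact ⟨R, S, fun i _ ↦ g i, hd, fun hb' ↦ absurd hb' hb.not_ge⟩

lemma sum_sq_norm_star_tensorVec_col_dotProduct {R : Matrix (Fin a) (Fin a) ℂ}
    {S : Fin a → Matrix (Fin b) (Fin b) ℂ} (hR : R ∈ Matrix.unitaryGroup (Fin a) ℂ)
    (hS : ∀ i, S i ∈ Matrix.unitaryGroup (Fin b) ℂ) (x : Fin a × Fin b → ℂ) :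
    ∑ i, ∑ j, ‖star (tensorVec (R.col i) ((S i).col j)) ⬝ᵥ x‖ ^ 2 = sqNorm x := by
  simp only [star_tensorVec_dotProduct, sum_sq_norm_col_dotProduct (hS _)]
  simp only [sqNorm, partialInner]
  rw [Finset.sum_comm, Fintype.sum_prod_type_right]
  exact Finset.sum_congr rfl fun j _ ↦ sum_sq_norm_col_dotProduct hR _

variable {R : Matrix (Fin a) (Fin a) ℂ} {S : Fin a → Matrix (Fin b) (Fin b) ℂ}
  {g : Fin a → Fin b → Fin 2}

/-- The deterministic post-processing that announces the label `g i j`, as a family of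
distributions on the labels. -/
def deltaLabel (g : Fin a → Fin b → Fin 2) (i : Fin a) (j : Fin b) (k : Fin 2) : ℝ :=
  if g i j = k then 1 else 0

lemma deltaLabel_eq_zero_or_one (g : Fin a → Fin b → Fin 2) (i : Fin a) (j : Fin b) (k : Fin 2) :
    deltaLabel g i j k = 0 ∨ deltaLabel g i j k = 1 :=
  (ite_eq_or_eq _ _ _).symm

lemma IsPerfectDiscrimination.isOneWayMeasurement (h : IsPerfectDiscrimination R S g x y) :
    IsOneWayMeasurement R S (deltaLabel g) where
  alice_mem := h.alice_mem
  bob_mem := h.bob_mem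
  nonneg i j k := by rcases deltaLabel_eq_zero_or_one g i j k with h | h <;> simp [h]
  add_eq_one i j := by rw [← Fin.sum_univ_two (deltaLabel g i j)]; simp [deltaLabel]

lemma IsPerfectDiscrimination.bornProb_zero (h : IsPerfectDiscrimination R S g x y)
    (hx : IsUnitVec x) (α β : ℂ) :
    bornProb (oneWayMeasurement R S (deltaLabel g) 0) (proj (α • x + β • y)) = ‖α‖ ^ 2 := by
  rw [← mul_one (‖α‖ ^ 2), ← isUnitVec_iff.1 hx,
    ← sum_sq_norm_star_tensorVec_col_dotProduct h.alice_mem h.bob_mem,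
    bornProb_oneWayMeasurement_proj]
  simp only [Finset.mul_sum]
  refine Finset.sum_congr rfl fun i _ ↦ Finset.sum_congr rfl fun j _ ↦ ?_
  rw [dotProduct_add, dotProduct_smul, dotProduct_smul]
  obtain hg | hg : g i j = 0 ∨ g i j = 1 := by omega
  · simp [deltaLabel, hg, h.right_eq_zero i j hg, mul_pow]
  · simp [deltaLabel, hg, h.left_eq_zero i j hg]

lemma IsPerfectDiscrimination.bornProb_one (h : IsPerfectDiscrimination R S g x y)
    (hy : IsUnitVec y) (α β : ℂ) :
    bornProb (oneWayMeasurement R S (deltaLabel g) 1) (proj (α • x + β • y)) = ‖β‖ ^ 2 := by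
  rw [← mul_one (‖β‖ ^ 2), ← isUnitVec_iff.1 hy,
    ← sum_sq_norm_star_tensorVec_col_dotProduct h.alice_mem h.bob_mem,
    bornProb_oneWayMeasurement_proj]
  simp only [Finset.mul_sum]
  refine Finset.sum_congr rfl fun i _ ↦ Finset.sum_congr rfl fun j _ ↦ ?_
  rw [dotProduct_add, dotProduct_smul, dotProduct_smul]
  obtain hg | hg : g i j = 0 ∨ g i j = 1 := by omega
  · simp [deltaLabel, hg, h.right_eq_zero i j hg]
  · simp [deltaLabel, hg, h.left_eq_zero i j hg, mul_pow]

end Discrimination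

/-! ### Optimal tests -/

section Rotation

variable {ι : Type} [Fintype ι]

lemma exists_isUnitVec_orthogonal_eq_smul [Nontrivial ι] {u d : ι → ℂ} (hu : IsUnitVec u)
    (hud : star u ⬝ᵥ d = 0) :
    ∃ v, IsUnitVec v ∧ star u ⬝ᵥ v = 0 ∧ d = ((√(sqNorm d) : ℝ) : ℂ) • v := by
  classical
  rcases eq_or_ne d 0 with rfl | hd
  · obtain ⟨i₀, i₁, hi⟩ := exists_pair_ne ι
    obtain ⟨S, hS, hu_col⟩ := exists_unitary_col_eq (s := {i₀}) (v := fun _ ↦ u)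
      (by simpa [IsUnitVec] using hu)
    have hcol := (mem_unitaryGroup_iff_col S).1 hS
    refine ⟨S.col i₁, (hcol i₁ i₁).trans (if_pos rfl), ?_, by simp⟩
    rw [← hu_col i₀ rfl, hcol, if_neg hi]
  · have hne : ((√(sqNorm d) : ℝ) : ℂ) ≠ 0 := by
      simpa [Real.sqrt_eq_zero (sqNorm_nonneg d), sqNorm_eq_zero] using hd
    exact ⟨_, isUnitVec_inv_sqrt_smul hd, by rw [dotProduct_smul, hud, smul_zero],
      (smul_inv_smul₀ hne d).symm⟩

lemma exists_eq_smul_add_sqrt_smul [Nontrivial ι] {u χ : ι → ℂ} (hu : IsUnitVec u) {z : ℝ}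
    (hz : star u ⬝ᵥ χ = z) :
    ∃ v, IsUnitVec v ∧ star u ⬝ᵥ v = 0 ∧
      χ = (z : ℂ) • u + ((√(sqNorm χ - z ^ 2) : ℝ) : ℂ) • v := by
  have horth : star u ⬝ᵥ (χ - (z : ℂ) • u) = 0 := by
    rw [dotProduct_sub, dotProduct_smul, hu, hz, smul_eq_mul, mul_one, sub_self]
  have hpyth : sqNorm χ = z ^ 2 + sqNorm (χ - (z : ℂ) • u) := by
    have hexpand := sqNorm_smul_add_smul z 1 u (χ - (z : ℂ) • u)
    rw [horth, isUnitVec_iff.1 hu] at hexpand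
    simpa using hexpand
  obtain ⟨v, hv, huv, hd⟩ := exists_isUnitVec_orthogonal_eq_smul hu horth
  refine ⟨v, hv, huv, ?_⟩
  rw [hpyth, add_sub_cancel_left, ← hd, add_sub_cancel]

lemma star_smul_add_smul_dotProduct {u v : ι → ℂ} (hu : IsUnitVec u) (hv : IsUnitVec v)
    (huv : star u ⬝ᵥ v = 0) (p q r t : ℝ) :
    star ((p : ℂ) • u + (q : ℂ) • v) ⬝ᵥ ((r : ℂ) • u + (t : ℂ) • v) =
      ((p * r + q * t : ℝ) : ℂ) := by
  have hvu : star v ⬝ᵥ u = 0 := by rw [Matrix.star_dotProduct, huv, star_zero]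
  rw [IsUnitVec] at hu hv
  simp only [star_add, star_smul, add_dotProduct, dotProduct_add, smul_dotProduct,
    dotProduct_smul, smul_eq_mul, huv, hvu, hu, hv, Complex.star_def, Complex.conj_ofReal]
  push_cast
  ring

/-- `φ` and `χ` are expanded in the orthonormal pair `x`, `y`, with squared moduli `α` of the
`y`-coefficient of `φ` and `β` of the `x`-coefficient of `χ`. Hence a measurement that tells `x`
from `y` tests `φ` against `χ` with type I error `α` and type II error `β`. -/
structure IsTestPair (φ χ x y : ι → ℂ) (α β : ℝ) : Prop where
  left_isUnitVec : IsUnitVec x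
  right_isUnitVec : IsUnitVec y
  orthogonal : star x ⬝ᵥ y = 0
  null_eq : ∃ p r : ℂ, φ = p • x + r • y ∧ ‖r‖ ^ 2 = α
  alternative_eq : ∃ p r : ℂ, χ = p • x + r • y ∧ ‖p‖ ^ 2 = β

lemma exists_norm_eq_one_star_smul_dotProduct (φ χ : ι → ℂ) :
    ∃ e : ℂ, ‖e‖ = 1 ∧ star (e • φ) ⬝ᵥ χ = (‖star φ ⬝ᵥ χ‖ : ℂ) := by
  obtain ⟨e, he, hphase⟩ : ∃ e : ℂ, ‖e‖ = 1 ∧ e * (‖star φ ⬝ᵥ χ‖ : ℂ) = star φ ⬝ᵥ χ :=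
    RCLike.exists_norm_mul_eq_self _
  refine ⟨e, he, ?_⟩
  rw [star_smul, smul_dotProduct, smul_eq_mul, ← hphase, ← mul_assoc, Complex.star_def,
    Complex.conj_mul', he, Complex.ofReal_one, one_pow, one_mul, hphase]

-- With `u` a multiple of `φ` and `v` orthogonal to it in the span of `φ` and `χ`, the pair `x`, `y`
-- is the pair `u`, `v` rotated by the angle whose cosine and sine are `c` and `s`.
lemma exists_isTestPair [Nontrivial ι] {φ χ : ι → ℂ} (hφ : IsUnitVec φ) (hχ : IsUnitVec χ)
    {c s : ℝ} (hcs : c ^ 2 + s ^ 2 = 1) :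
    ∃ x y, IsTestPair φ χ x y (s ^ 2)
      ((‖star φ ⬝ᵥ χ‖ * c - √(1 - ‖star φ ⬝ᵥ χ‖ ^ 2) * s) ^ 2) := by
  obtain ⟨e, he, huχ⟩ := exists_norm_eq_one_star_smul_dotProduct φ χ
  have hu : IsUnitVec (e • φ) := by
    rw [isUnitVec_iff, sqNorm_smul, he, isUnitVec_iff.1 hφ, one_pow, mul_one]
  have hφu : φ = star e • e • φ := by
    rw [smul_smul, Complex.star_def, Complex.conj_mul', he, Complex.ofReal_one, one_pow, one_smul]
  obtain ⟨v, hv, huv, hχuv⟩ := exists_eq_smul_add_sqrt_smul hu huχ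
  rw [isUnitVec_iff.1 hχ] at hχuv
  generalize ‖star φ ⬝ᵥ χ‖ = z at hχuv ⊢
  generalize √(1 - z ^ 2) = w at hχuv ⊢
  generalize e • φ = u at hu huv hφu hχuv
  have hdot := star_smul_add_smul_dotProduct hu hv huv
  have hcs' : (c : ℂ) ^ 2 + (s : ℂ) ^ 2 = 1 := by exact_mod_cast hcs
  refine ⟨(c : ℂ) • u + ((-s : ℝ) : ℂ) • v, (s : ℂ) • u + (c : ℂ) • v, ⟨?_, ?_, ?_,
    ⟨star e * c, star e * s, ?_, ?_⟩,
    ⟨((z * c - w * s : ℝ) : ℂ), ((z * s + w * c : ℝ) : ℂ), ?_, ?_⟩⟩⟩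
  · rw [IsUnitVec, hdot, Complex.ofReal_eq_one, ← hcs]; ring
  · rw [IsUnitVec, hdot, Complex.ofReal_eq_one, ← hcs]; ring
  · rw [hdot, Complex.ofReal_eq_zero]; ring
  · rw [hφu]
    push_cast
    match_scalars
    · linear_combination (-star e) * hcs'
    · ring
  · rw [norm_mul, norm_star, he, one_mul, Complex.norm_real, Real.norm_eq_abs, sq_abs]
  · rw [hχuv]
    push_cast
    match_scalars
    · linear_combination (-(z : ℂ)) * hcs'
    · linear_combination (-(w : ℂ)) * hcs'
  · rw [Complex.norm_real, Real.norm_eq_abs, sq_abs]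

end Rotation

section OptimalTest

lemma exists_optimalError_eq {z δ : ℝ} (hz : 0 ≤ z) (hz1 : z ≤ 1) (hδ : 0 ≤ δ) (hδ1 : δ ≤ 1) :
    ∃ c s : ℝ, c ^ 2 + s ^ 2 = 1 ∧ s ^ 2 ≤ δ ∧
      optimalError z δ = (z * c - √(1 - z ^ 2) * s) ^ 2 := by
  rw [optimalError]
  split_ifs with h
  · refine ⟨√(1 - z ^ 2), z, ?_, (Real.le_sqrt hz hδ).1 h, by ring⟩
    rw [Real.sq_sqrt (sub_nonneg.2 (pow_le_one₀ hz hz1)), sub_add_cancel]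
  · refine ⟨√(1 - δ), √δ, ?_, (Real.sq_sqrt hδ).le, rfl⟩
    rw [Real.sq_sqrt hδ, Real.sq_sqrt (sub_nonneg.2 hδ1), sub_add_cancel]

lemma optimalError_one {δ : ℝ} (hδ1 : δ ≤ 1) : optimalError 1 δ = 1 - δ := by
  rw [optimalError]
  split_ifs with h
  · rw [Real.one_le_sqrt] at h
    linarith
  · simp [Real.sq_sqrt (sub_nonneg.2 hδ1)]

lemma norm_star_dotProduct_comm {ι : Type} [Fintype ι] (x y : ι → ℂ) :
    ‖star x ⬝ᵥ y‖ = ‖star y ⬝ᵥ x‖ := by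
  rw [Matrix.star_dotProduct x y, norm_star]

lemma norm_star_dotProduct_le_one {ι : Type} [Fintype ι] {x y : ι → ℂ} (hx : IsUnitVec x)
    (hy : IsUnitVec y) : ‖star x ⬝ᵥ y‖ ≤ 1 := by
  simpa [isUnitVec_iff.1 hx, isUnitVec_iff.1 hy] using norm_star_dotProduct_le x y

lemma norm_star_dotProduct_of_subsingleton {ι : Type} [Fintype ι] [Subsingleton ι] (i : ι)
    {x y : ι → ℂ} (hx : IsUnitVec x) (hy : IsUnitVec y) : ‖star x ⬝ᵥ y‖ = 1 := by
  have hnorm {v : ι → ℂ} (hv : IsUnitVec v) : ‖v i‖ = 1 := by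
    rw [isUnitVec_iff, sqNorm, Fintype.sum_subsingleton _ i] at hv
    exact (pow_eq_one_iff_of_nonneg (norm_nonneg _) two_ne_zero).1 hv
  rw [dotProduct, Fintype.sum_subsingleton _ i, norm_mul, Pi.star_apply, norm_star, hnorm hx,
    hnorm hy, one_mul]

variable {d₁ d₂ : ℕ}

/-- A measurement with one-way communication whose post-processing is deterministic and uses only
Bob's outcome, as far as the dimensions allow. -/
structure IsOneWayTest (R : Matrix (Fin d₁) (Fin d₁) ℂ) (S : Fin d₁ → Matrix (Fin d₂) (Fin d₂) ℂ)
    (f : Fin d₁ → Fin d₂ → Fin 2 → ℝ) : Prop extends IsOneWayMeasurement R S f where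
  deterministic : 2 ≤ d₁ * d₂ → ∀ i j k, f i j k = 0 ∨ f i j k = 1
  bob_decides : 2 ≤ d₂ → ∀ i i', f i = f i'

variable {δ : ℝ}

lemma exists_isOneWayTest_of_two_le_mul (hd : 2 ≤ d₁ * d₂) {φ χ : Fin d₁ × Fin d₂ → ℂ}
    (hφ : IsUnitVec φ) (hχ : IsUnitVec χ) (hδ : 0 ≤ δ) (hδ1 : δ ≤ 1) :
    ∃ R S f, IsOneWayTest R S f ∧ bornProb (oneWayMeasurement R S f 1) (proj φ) ≤ δ ∧
      bornProb (oneWayMeasurement R S f 0) (proj χ) = optimalError ‖star φ ⬝ᵥ χ‖ δ := by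
  have : Nontrivial (Fin d₁ × Fin d₂) := by
    rw [← Fintype.one_lt_card_iff_nontrivial, Fintype.card_prod, Fintype.card_fin,
      Fintype.card_fin]
    exact hd
  obtain ⟨c, s, hcs, hsδ, hopt⟩ := exists_optimalError_eq (norm_nonneg _)
    (norm_star_dotProduct_le_one hφ hχ) hδ hδ1
  obtain ⟨x, y, hxy⟩ := exists_isTestPair hφ hχ hcs
  obtain ⟨p, r, hφ_eq, hr⟩ := hxy.null_eq
  obtain ⟨p', r', hχ_eq, hp'⟩ := hxy.alternative_eq
  obtain ⟨R, S, g, hdisc, hbob⟩ := exists_isPerfectDiscrimination hd hxy.orthogonal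
  refine ⟨R, S, deltaLabel g, ⟨hdisc.isOneWayMeasurement, fun _ ↦ deltaLabel_eq_zero_or_one g,
    fun h i i' ↦ ?_⟩, ?_, ?_⟩
  · ext j k
    rw [deltaLabel, deltaLabel, hbob h i i']
  · rwa [hφ_eq, hdisc.bornProb_one hxy.right_isUnitVec, hr]
  · rw [hopt, ← hp', hχ_eq, hdisc.bornProb_zero hxy.left_isUnitVec]

lemma exists_isOneWayTest_of_dim_one {φ χ : Fin 1 × Fin 1 → ℂ} (hφ : IsUnitVec φ)
    (hχ : IsUnitVec χ) (hδ : 0 ≤ δ) (hδ1 : δ ≤ 1) :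
    ∃ R S f, IsOneWayTest R S f ∧ bornProb (oneWayMeasurement R S f 1) (proj φ) ≤ δ ∧
      bornProb (oneWayMeasurement R S f 0) (proj χ) = optimalError ‖star φ ⬝ᵥ χ‖ δ := by
  have hcoin (k : Fin 2) {x : Fin 1 × Fin 1 → ℂ} (hx : IsUnitVec x) :
      bornProb (oneWayMeasurement 1 (fun _ ↦ 1) (fun _ _ ↦ ![1 - δ, δ]) k) (proj x) =
        ![1 - δ, δ] k := by
    rw [bornProb_oneWayMeasurement_proj]
    simp only [← Finset.mul_sum]
    rw [sum_sq_norm_star_tensorVec_col_dotProduct (one_mem _) (fun _ ↦ one_mem _),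
      isUnitVec_iff.1 hx, mul_one]
  refine ⟨1, fun _ ↦ 1, fun _ _ ↦ ![1 - δ, δ], ⟨⟨one_mem _, fun _ ↦ one_mem _, fun _ _ ↦ ?_,
    fun _ _ ↦ sub_add_cancel 1 δ⟩, by norm_num, by norm_num⟩, (hcoin 1 hφ).le, ?_⟩
  · simp [Fin.forall_fin_two, hδ, hδ1]
  · rw [norm_star_dotProduct_of_subsingleton (0, 0) hφ hχ, optimalError_one hδ1]
    exact hcoin 0 hχ

theorem exists_isOneWayTest (hd₁ : 1 ≤ d₁) (hd₂ : 1 ≤ d₂) {φ χ : Fin d₁ × Fin d₂ → ℂ}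
    (hφ : IsUnitVec φ) (hχ : IsUnitVec χ) (hδ : 0 ≤ δ) (hδ1 : δ ≤ 1) :
    ∃ R S f, IsOneWayTest R S f ∧ bornProb (oneWayMeasurement R S f 1) (proj φ) ≤ δ ∧
      bornProb (oneWayMeasurement R S f 0) (proj χ) = optimalError ‖star φ ⬝ᵥ χ‖ δ := by
  rcases le_or_gt 2 (d₁ * d₂) with hd | hd
  · exact exists_isOneWayTest_of_two_le_mul hd hφ hχ hδ hδ1
  · have hdim : d₁ * d₂ = 1 := le_antisymm (Nat.le_of_lt_succ hd) (Nat.mul_pos hd₁ hd₂)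
    obtain ⟨rfl, rfl⟩ := mul_eq_one.1 hdim
    exact exists_isOneWayTest_of_dim_one hφ hχ hδ hδ1

theorem exists_isOneWayTest_unitaryChannel (hd₁ : 1 ≤ d₁) (hd₂ : 1 ≤ d₂) {U V : BiOp d₁ d₂}
    (hU : U ∈ Matrix.unitaryGroup (Fin d₁ × Fin d₂) ℂ)
    (hV : V ∈ Matrix.unitaryGroup (Fin d₁ × Fin d₂) ℂ) {ψ : Fin d₁ × Fin d₂ → ℂ}
    (hψ : IsUnitVec ψ) (hδ : 0 ≤ δ) (hδ1 : δ ≤ 1) :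
    ∃ R S f, IsOneWayTest R S f ∧
      bornProb (oneWayMeasurement R S f 1) (unitaryChannel U (proj ψ)) ≤ δ ∧
      bornProb (oneWayMeasurement R S f 0) (unitaryChannel V (proj ψ)) =
        optimalError ‖quadForm (Vᴴ * U) ψ‖ δ := by
  rw [unitaryChannel_proj, unitaryChannel_proj, quadForm_conjTranspose_mul,
    norm_star_dotProduct_comm]
  exact exists_isOneWayTest hd₁ hd₂ (hψ.mulVec hU) (hψ.mulVec hV) hδ hδ1

lemma IsUnitVec.comp_equiv {ι κ : Type} [Fintype ι] [Fintype κ] {x : ι → ℂ} (hx : IsUnitVec x)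
    (e : κ ≃ ι) : IsUnitVec (x ∘ e) := by
  rwa [isUnitVec_iff, sqNorm_comp_equiv, ← isUnitVec_iff]

theorem optimalError_mem_typeIIErrors (hd₁ : 1 ≤ d₁) (hd₂ : 1 ≤ d₂) {U V : BiOp d₁ d₂}
    (hU : U ∈ Matrix.unitaryGroup (Fin d₁ × Fin d₂) ℂ)
    (hV : V ∈ Matrix.unitaryGroup (Fin d₁ × Fin d₂) ℂ) {a : Fin d₁ → ℂ} {b : Fin d₂ → ℂ}
    (ha : IsUnitVec a) (hb : IsUnitVec b) (hδ : 0 ≤ δ) (hδ1 : δ ≤ 1) :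
    optimalError ‖quadForm (Vᴴ * U) (tensorVec a b)‖ δ ∈ typeIIErrors U V δ := by
  let e (d : ℕ) : Fin (d * 1) ≃ Fin d := finProdFinEquiv.symm.trans (Equiv.prodUnique _ _)
  have ha' := ha.comp_equiv (e d₁)
  have hb' := hb.comp_equiv (e d₂)
  obtain ⟨R, S, f, htest, hI, hII⟩ := exists_isOneWayTest_unitaryChannel
    (by rwa [mul_one]) (by rwa [mul_one]) (extendedOp_mem_unitaryGroup 1 1 hU)
    (extendedOp_mem_unitaryGroup 1 1 hV) (ha'.tensorVec hb') hδ hδ1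
  refine ⟨1, 1, _, _, isLOCCState_proj_tensorVec ha' hb', htest.isLOCCMeasurement, ?_, ?_⟩
  · rwa [extendedChannel_eq]
  · rw [extendedChannel_eq, hII, conjTranspose_extendedOp_mul, quadForm_extendedOp_tensorVec]
    simp [e, Equiv.prodUnique]

end OptimalTest

end LocalCertification

theorem theorem1 (d₁ d₂ : ℕ) (hd₁ : 1 ≤ d₁) (hd₂ : 1 ≤ d₂)
    (U V : Matrix (Fin d₁ × Fin d₂) (Fin d₁ × Fin d₂) ℂ)
    (hU : U ∈ Matrix.unitaryGroup (Fin d₁ × Fin d₂) ℂ)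
    (hV : V ∈ Matrix.unitaryGroup (Fin d₁ × Fin d₂) ℂ) :
    -- the distance `z` is attained
    IsLeast ((fun w : ℂ => ‖w‖) '' LocalCertification.productNumericalRange (Vᴴ * U))
      (LocalCertification.distToZero (Vᴴ * U)) ∧
    -- the optimal type II error, over LOCC states and measurements with arbitrary ancillas
    (∀ δ : ℝ, 0 ≤ δ → δ ≤ 1 →
      IsLeast (LocalCertification.typeIIErrors U V δ)
        (LocalCertification.optimalError (LocalCertification.distToZero (Vᴴ * U)) δ)) ∧
    -- it is attained without ancillas, from every pure product state that minimizes
    -- `|⟨a,b|V†U|a,b⟩|` (whatever `δ` is), by a measurement with one-way communication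
    (∀ (a : Fin d₁ → ℂ) (b : Fin d₂ → ℂ),
      LocalCertification.IsUnitVec a → LocalCertification.IsUnitVec b →
      ‖LocalCertification.quadForm (Vᴴ * U) (LocalCertification.tensorVec a b)‖ =
        LocalCertification.distToZero (Vᴴ * U) →
      LocalCertification.IsLOCCState
        (LocalCertification.proj (LocalCertification.tensorVec a b)) ∧
      ∀ δ : ℝ, 0 ≤ δ → δ ≤ 1 →
        ∃ (R : Matrix (Fin d₁) (Fin d₁) ℂ) (S : Fin d₁ → Matrix (Fin d₂) (Fin d₂) ℂ)
          (f : Fin d₁ → Fin d₂ → Fin 2 → ℝ),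
          R ∈ Matrix.unitaryGroup (Fin d₁) ℂ ∧
          (∀ i, S i ∈ Matrix.unitaryGroup (Fin d₂) ℂ) ∧
          (∀ i j k, 0 ≤ f i j k) ∧ (∀ i j, f i j 0 + f i j 1 = 1) ∧
          -- no randomness is needed unless `d₁ = d₂ = 1`
          (2 ≤ d₁ * d₂ → ∀ i j k, f i j k = 0 ∨ f i j k = 1) ∧
          -- Bob's outcome alone decides unless `d₂ = 1`
          (2 ≤ d₂ → ∀ i i', f i = f i') ∧
          LocalCertification.IsLOCCMeasurement
            (LocalCertification.oneWayMeasurement R S f) ∧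
          LocalCertification.bornProb (LocalCertification.oneWayMeasurement R S f 1)
            (LocalCertification.unitaryChannel U
              (LocalCertification.proj (LocalCertification.tensorVec a b))) ≤ δ ∧
          LocalCertification.bornProb (LocalCertification.oneWayMeasurement R S f 0)
            (LocalCertification.unitaryChannel V
              (LocalCertification.proj (LocalCertification.tensorVec a b))) =
            LocalCertification.optimalError
              (LocalCertification.distToZero (Vᴴ * U)) δ) := by
  refine ⟨LocalCertification.isLeast_distToZero hd₁ hd₂ _, fun δ hδ hδ1 ↦
    ⟨?_, fun p hp ↦ LocalCertification.optimalError_le_of_mem_typeIIErrors hU hV hδ1 hp⟩,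
    fun a b ha hb hz ↦
      ⟨LocalCertification.isLOCCState_proj_tensorVec ha hb, fun δ hδ hδ1 ↦ ?_⟩⟩
  · obtain ⟨_, ⟨a, b, ha, hb, rfl⟩, hz⟩ :=
      (LocalCertification.isLeast_distToZero hd₁ hd₂ (Vᴴ * U)).1
    rw [← hz]
    exact LocalCertification.optimalError_mem_typeIIErrors hd₁ hd₂ hU hV ha hb hδ hδ1
  · obtain ⟨R, S, f, htest, hI, hII⟩ := LocalCertification.exists_isOneWayTest_unitaryChannel
      hd₁ hd₂ hU hV (ha.tensorVec hb) hδ hδ1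
    rw [hz] at hII
    exact ⟨R, S, f, htest.alice_mem, htest.bob_mem, htest.nonneg, htest.add_eq_one,
      htest.deterministic, htest.bob_decides, htest.isLOCCMeasurement, hI, hII⟩
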